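/- Let $H$ be a (time-independent) Hermitian operator on $n$ qubits, $U(t)=e^{-iHt}$, $|\psi_0\rangle$ an $n$-qubit pure state, $T\in\mathbb R$, $N=2^k$ with $k\ge 0$, $\varepsilon=T/N$, and let $$|\Psi\rangle=\frac1{\sqrt N}\sum_{t=0}^{N-1}|t\rangle\otimes U(\varepsilon t)|\psi_0\rangle$$ be the discrete history state, $\rho_T=\mathrm{Tr}_S|\Psi\rangle\langle\Psi|$ the reduced state of the $\log_2 N$ clock qubits, and $E_2=1-\mathrm{Tr}[\rho_T^2]$ the system–time linear entropy. A history state is prepared from $|0\rangle^{\otimes k}\otimes|\psi_0\rangle$ by a Hadamard gate on each clock qubit followed, for $j=0,\dots,k-1$, by the gate $U(2^j\varepsilon)$ on the system controlled by the clock qubit $j$ (the binary digit of $t$ of weight $2^j$). (1) *State overlap.* One experiment prepares two copies of the history state, applies to each pair of corresponding clock qubits a CNOT (control in the first copy) and then a Hadamard gate on the qubit of the first copy, and measures the clock qubits of both copies in the computational basis (i.e. measures each pair in the Bell basis). The circuit has $2n+2\log_2 N$ qubits. To an outcome assign the sign $s=\prod_j(-1)^{a_jb_j}$, where $a_j,b_j$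 are the bits of the $j$-th clock qubits of the first and the second copy. For every $\eta>0$ there is a constant $C>0$, depending on $\eta$ only, such that for all $n,k,H,\psi_0,T$, all $\delta>0$ and every number $M\ge C/\delta^2$ of independent experiments, with outcome signs $s_1,\dots,s_M$, $$\Pr\Big[\Big|\Big(1-\frac1M\sum_{i=1}^M s_i\Big)-E_2\Big|\le\delta\Big]\ge 1-\eta .$$ (2) *Randomized measurements.* One experiment prepares one copy of the history state, applies to each clock qubit, independently and uniformly at random, one of the unitaries $\mathrm{Had}$, $\mathrm{Had}\,S^\dagger$, $\mathbb 1$ (with $\mathrm{Had}$ the Hadamard gate and $S^\dagger=\mathrm{diag}(1,-i)$; this is a measurement of a random Pauli observable $X$, $Y$ or $Z$), measures the clock qubits in the computational basis, and records the unitaries applied and the outcomes (a classical shadow of $\rho_T$). The circuit has $n+\log_2 N$ qubits. There are classical post-processing functions $e_{k,M}$, real-valued functions of $M$ records of $k$ clock qubits that depend on $k$ and $M$ only, such that for every $\eta>0$ there is a constant $C>0$, depending on $\eta$ only, with the following property: for all $n,k,H,\psi_0,T$, all $\delta>0$ and every number $M\ge CN/\delta^2$ of independent experiments with records $r_1,\dots,r_M$,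 $$\Pr\big[\,|e_{k,M}(r_1,\dots,r_M)-E_2|\le\delta\,\big]\ge 1-\eta .$$ -/

import Mathlib

open scoped Matrix

noncomputable section

/-! Quantum states and circuits on a register whose qubits are labelled by a type `ι`.
The computational basis of the register is `ι → Bool` (`true` is the basis value `1`), and a pure
state is the family of its amplitudes. -/

/-- Pure states (amplitude vectors) of the qubits labelled by `ι`. -/
abbrev QState (ι : Type) : Type := (ι → Bool) → ℂ

/-- A gate: a unitary matrix on `arity` target qubits, possibly controlled by a further qubit. -/
structure Gate (ι : Type) where
  /-- number of target qubits -/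
  arity : ℕ
  /-- the target qubits, in order -/
  target : Fin arity → ι
  /-- the target qubits are distinct -/
  target_injective : Function.Injective target
  /-- the control qubit, if there is one -/
  control : Option ι
  /-- the control qubit is not a target -/
  control_not_target : ∀ c ∈ control, ∀ i, target i ≠ c
  /-- the matrix that acts on the target qubits -/
  mat : Matrix (Fin arity → Bool) (Fin arity → Bool) ℂ
  /-- the matrix is unitary -/
  unitary : mat ∈ Matrix.unitaryGroup (Fin arity → Bool) ℂ

/-- The action of a gate on a state. A controlled gate acts on the basis states whose control qubit
is `1` only. `Function.extend g.target y x` is the basis state `x` with its target bits replaced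
by `y`. -/
def Gate.apply {ι : Type} (g : Gate ι) (ψ : QState ι) : QState ι := fun x =>
  if ∀ c ∈ g.control, x c = true then
    ∑ y : Fin g.arity → Bool, g.mat (fun i => x (g.target i)) y * ψ (Function.extend g.target y x)
  else ψ x

/-- A circuit is a list of gates; the first gate of the list acts first. -/
abbrev Circuit (ι : Type) : Type := List (Gate ι)

/-- The state in which a circuit leaves a given input state. -/
def Circuit.run {ι : Type} (c : Circuit ι) (ψ : QState ι) : QState ι :=
  c.foldl (fun φ g => g.apply φ) ψ

/-- The Born rule: probability of the outcome `o` when the qubits `q m` (`m : μ`) of the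
state `ψ` are measured in the computational basis and all the others are ignored. -/
def bornProb {ι μ : Type} [Fintype ι] [DecidableEq ι] [Fintype μ]
    (ψ : QState ι) (q : μ → ι) (o : μ → Bool) : ℝ :=
  ∑ x : ι → Bool, if ∀ m, x (q m) = o m then ‖ψ x‖ ^ 2 else 0

open Classical in
/-- The probability of the event `E` in `M` independent repetitions of an experiment which gives
the result `a` with probability `p a`. -/
def repeatProb {α : Type} [Fintype α] (p : α → ℝ) (M : ℕ) (E : Set (Fin M → α)) : ℝ :=
  ∑ r : Fin M → α, if r ∈ E then ∏ i, p (r i) else 0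

/-! Elementary gates. -/

/-- The Hadamard matrix. -/
def hadamardMat : Matrix Bool Bool ℂ :=
  Matrix.of fun a b => ((1 / Real.sqrt 2 : ℝ) : ℂ) * (if a && b then -1 else 1)

/-- The Pauli matrix `X`. -/
def pauliXMat : Matrix Bool Bool ℂ := Matrix.of fun a b => if a = b then 0 else 1

/-- The matrix `S† = diag(1, -i)`. -/
def sDaggerMat : Matrix Bool Bool ℂ :=
  Matrix.diagonal fun a => if a then -Complex.I else 1

theorem hadamardMat_mem : hadamardMat ∈ Matrix.unitaryGroup Bool ℂ := by
  have h : ((Real.sqrt 2 : ℝ) : ℂ) * ((Real.sqrt 2 : ℝ) : ℂ) = 2 := by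
    rw [← Complex.ofReal_mul, Real.mul_self_sqrt (by norm_num)]
    norm_num
  have h0 : ((Real.sqrt 2 : ℝ) : ℂ) ≠ 0 := by
    intro h1
    rw [h1] at h
    norm_num at h
  rw [Matrix.mem_unitaryGroup_iff]
  ext a b
  cases a <;> cases b <;>
    simp [hadamardMat, Matrix.mul_apply, Matrix.star_apply] <;>
    (rw [← mul_inv, h]; norm_num)

theorem pauliXMat_mem : pauliXMat ∈ Matrix.unitaryGroup Bool ℂ := by
  rw [Matrix.mem_unitaryGroup_iff]
  ext a b
  cases a <;> cases b <;> simp [pauliXMat, Matrix.mul_apply, Matrix.star_apply]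

theorem sDaggerMat_mem : sDaggerMat ∈ Matrix.unitaryGroup Bool ℂ := by
  rw [Matrix.mem_unitaryGroup_iff]
  ext a b
  cases a <;> cases b <;> simp [sDaggerMat, Matrix.mul_apply, Matrix.star_apply]

/-- A one-qubit matrix as a matrix on the basis `Fin 1 → Bool`. -/
def oneQubit (u : Matrix Bool Bool ℂ) : Matrix (Fin 1 → Bool) (Fin 1 → Bool) ℂ :=
  Matrix.of fun x y => u (x 0) (y 0)

theorem oneQubit_mem {u : Matrix Bool Bool ℂ} (hu : u ∈ Matrix.unitaryGroup Bool ℂ) :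
    oneQubit u ∈ Matrix.unitaryGroup (Fin 1 → Bool) ℂ := by
  rw [Matrix.mem_unitaryGroup_iff] at hu ⊢
  ext x y
  have h := congrFun (congrFun hu (x 0)) (y 0)
  have hxy : x = y ↔ x 0 = y 0 :=
    ⟨fun e => by rw [e], fun e => by ext i; rw [Subsingleton.elim i 0, e]⟩
  have hs : ∀ f : Bool → ℂ, ∑ z : Fin 1 → Bool, f (z 0) = ∑ b : Bool, f b := fun f =>
    Fintype.sum_equiv (Equiv.funUnique (Fin 1) Bool) _ _ (fun z => rfl)
  simp only [Matrix.mul_apply, Matrix.star_apply, Matrix.one_apply, oneQubit, Matrix.of_apply,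
    hxy] at h ⊢
  rw [← h]
  exact hs fun b => u (x 0) b * star (u (y 0) b)

/-- The one-qubit gate `u` on the qubit `q`. -/
def gateOn {ι : Type} (u : Matrix Bool Bool ℂ) (hu : u ∈ Matrix.unitaryGroup Bool ℂ) (q : ι) :
    Gate ι where
  arity := 1
  target := fun _ => q
  target_injective := fun a b _ => Subsingleton.elim a b
  control := none
  control_not_target := by simp
  mat := oneQubit u
  unitary := oneQubit_mem hu

/-- The Hadamard gate on the qubit `q`. -/
def hadamardOn {ι : Type} (q : ι) : Gate ι := gateOn hadamardMat hadamardMat_mem q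

/-- The CNOT gate with control `c` and target `q`. -/
def cnotOn {ι : Type} (c q : ι) (h : q ≠ c) : Gate ι where
  arity := 1
  target := fun _ => q
  target_injective := fun a b _ => Subsingleton.elim a b
  control := some c
  control_not_target := by
    intro c' hc' _
    rw [Option.mem_some_iff] at hc'
    rw [← hc']
    exact h
  mat := oneQubit pauliXMat
  unitary := oneQubit_mem pauliXMat_mem

/-! Time evolution, the history state and the linear entropy. -/

/-- The evolution operator `U(t) = exp(-i H t)` of `n` qubits. -/
def evolution {n : ℕ} (H : Matrix (Fin n → Bool) (Fin n → Bool) ℂ) (t : ℝ) :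
    Matrix (Fin n → Bool) (Fin n → Bool) ℂ :=
  NormedSpace.exp ((-(Complex.I * (t : ℂ))) • H)

theorem evolution_mem {n : ℕ} {H : Matrix (Fin n → Bool) (Fin n → Bool) ℂ}
    (hH : H.IsHermitian) (t : ℝ) :
    evolution H t ∈ Matrix.unitaryGroup (Fin n → Bool) ℂ := by
  have h : ((-(Complex.I * (t : ℂ))) • H)ᴴ = -((-(Complex.I * (t : ℂ))) • H) := by
    rw [Matrix.conjTranspose_smul, hH.eq]
    simp
  rw [Matrix.mem_unitaryGroup_iff, Matrix.star_eq_conjTranspose, evolution,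
    ← Matrix.exp_conjTranspose, h,
    ← Matrix.exp_add_of_commute _ _ (by simp only [Commute, SemiconjBy, mul_neg, neg_mul]),
    add_neg_cancel, NormedSpace.exp_zero]

/-- The discrete history state
`|Ψ⟩ = N^(-1/2) ∑ t, |t⟩ ⊗ U(ε t)|ψ₀⟩`, `ε = T / N`, `t = 0, …, N - 1`; here `Ψ (t, x)` is
the amplitude of `|t⟩ ⊗ |x⟩`. -/
def historyState {n : ℕ} (N : ℕ) (H : Matrix (Fin n → Bool) (Fin n → Bool) ℂ) (T : ℝ)
    (ψ₀ : QState (Fin n)) : Fin N × (Fin n → Bool) → ℂ := fun p =>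
  ((1 / Real.sqrt N : ℝ) : ℂ) * (evolution H (T / N * (p.1 : ℕ)) *ᵥ ψ₀) p.2

/-- The partial trace over the second factor. -/
def partialTraceRight {α β : Type} [Fintype β] (ρ : Matrix (α × β) (α × β) ℂ) : Matrix α α ℂ :=
  Matrix.of fun a a' => ∑ b, ρ (a, b) (a', b)

/-- The reduced state `ρ_T = Tr_S |Ψ⟩⟨Ψ|` of the clock. -/
def clockState {n : ℕ} (N : ℕ) (H : Matrix (Fin n → Bool) (Fin n → Bool) ℂ) (T : ℝ)
    (ψ₀ : QState (Fin n)) : Matrix (Fin N) (Fin N) ℂ :=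
  partialTraceRight
    (Matrix.vecMulVec (historyState N H T ψ₀) (star (historyState N H T ψ₀)))

/-- The system-time linear entropy `E₂ = 1 - Tr ρ_T²` (the trace is real). -/
def linearEntropy {n : ℕ} (N : ℕ) (H : Matrix (Fin n → Bool) (Fin n → Bool) ℂ) (T : ℝ)
    (ψ₀ : QState (Fin n)) : ℝ :=
  1 - (Matrix.trace (clockState N H T ψ₀ * clockState N H T ψ₀)).re

/-! The circuits. The clock has `k` qubits, so `N = 2 ^ k`, and clock qubit `j` (`j = 0, …, k - 1`)
carries the binary digit of weight `2 ^ j`. -/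

/-- The qubits of one history state: `k` clock qubits and `n` system qubits. -/
abbrev HistoryQubit (n k : ℕ) : Type := Fin k ⊕ Fin n

/-- The preparation of a history state on the qubits `e q` of a register: a Hadamard gate on each
clock qubit, then the gate `U(2 ^ j ε)` on the system controlled by clock qubit `j`, for each
`j`. -/
def historyCircuit {ι : Type} {n k : ℕ} (e : HistoryQubit n k ↪ ι)
    {H : Matrix (Fin n → Bool) (Fin n → Bool) ℂ} (hH : H.IsHermitian) (ε : ℝ) : Circuit ι :=
  (List.ofFn fun j : Fin k => hadamardOn (e (Sum.inl j))) ++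
  List.ofFn fun j : Fin k =>
    { arity := n
      target := fun i => e (Sum.inr i)
      target_injective := fun _ _ h => Sum.inr_injective (e.injective h)
      control := some (e (Sum.inl j))
      control_not_target := by
        intro c hc i
        rw [Option.mem_some_iff] at hc
        rw [← hc]
        exact fun h => Sum.inr_ne_inl (e.injective h)
      mat := evolution H (2 ^ (j : ℕ) * ε)
      unitary := evolution_mem hH _ }

/-- The input `|0…0⟩ ⊗ |ψ₀⟩` of the preparation of one history state. -/
def historyInput {n : ℕ} (k : ℕ) (ψ₀ : QState (Fin n)) : QState (HistoryQubit n k) := fun x =>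
  if ∀ j : Fin k, x (Sum.inl j) = false then ψ₀ (fun i => x (Sum.inr i)) else 0

/-- The qubits of the state-overlap circuit: two copies of the history register. -/
abbrev OverlapQubit (n k : ℕ) : Type := Fin 2 × HistoryQubit n k

/-- The embedding of the history register as copy `a` of the overlap register. -/
def copyEmb {n k : ℕ} (a : Fin 2) : HistoryQubit n k ↪ OverlapQubit n k :=
  ⟨fun q => (a, q), fun _ _ h => (Prod.mk.inj h).2⟩

/-- The state-overlap circuit: prepare two copies of the history state, then rotate each pair of
corresponding clock qubits from the Bell basis to the computational basis (CNOT, then Hadamard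
on the first qubit of the pair). -/
def overlapCircuit {n : ℕ} (k : ℕ) {H : Matrix (Fin n → Bool) (Fin n → Bool) ℂ}
    (hH : H.IsHermitian) (ε : ℝ) : Circuit (OverlapQubit n k) :=
  historyCircuit (copyEmb 0) hH ε ++ historyCircuit (copyEmb 1) hH ε ++
  (List.ofFn fun j : Fin k =>
    cnotOn ((0, Sum.inl j) : OverlapQubit n k) (1, Sum.inl j)
      (fun h => one_ne_zero (congrArg Prod.fst h))) ++
  List.ofFn fun j : Fin k => hadamardOn ((0, Sum.inl j) : OverlapQubit n k)

/-- The probability of the outcome `o` in one run of the state-overlap circuit, in which the clock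
qubits of both copies are measured; `o (a, j)` is the bit of clock qubit `j` of copy `a`. -/
def overlapProb {n : ℕ} (k : ℕ) {H : Matrix (Fin n → Bool) (Fin n → Bool) ℂ}
    (hH : H.IsHermitian) (ε : ℝ) (ψ₀ : QState (Fin n)) (o : Fin 2 × Fin k → Bool) : ℝ :=
  bornProb
    ((overlapCircuit k hH ε).run fun x =>
      historyInput k ψ₀ (fun q => x (0, q)) * historyInput k ψ₀ (fun q => x (1, q)))
    (fun m => (m.1, Sum.inl m.2)) o

/-- The eigenvalue of the product of the SWAP operators of the pairs of clock qubits that belongs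
to the outcome `o`: each pair found in the singlet state (outcome `11`) contributes `-1`. -/
def swapSign {k : ℕ} (o : Fin 2 × Fin k → Bool) : ℝ :=
  ∏ j : Fin k, if o (0, j) && o (1, j) then -1 else 1

/-- The estimate of `E₂` from `M` runs of the state-overlap circuit: one minus the
empirical mean of the SWAP eigenvalue. -/
def overlapEstimate {k M : ℕ} (r : Fin M → Fin 2 × Fin k → Bool) : ℝ :=
  1 - (∑ i, swapSign (r i)) / M

/-- The three Pauli measurement axes of a qubit. -/
inductive PauliAxis : Type
  | x
  | y
  | z
  deriving DecidableEq

instance : Fintype PauliAxis :=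
  ⟨{PauliAxis.x, PauliAxis.y, PauliAxis.z}, fun a => by cases a <;> simp⟩

/-- The gate applied before a measurement in the computational basis in order to measure the given
Pauli observable: `H` for `X`, `H S†` for `Y` and the identity for `Z`. -/
def axisMat : PauliAxis → Matrix Bool Bool ℂ
  | .x => hadamardMat
  | .y => hadamardMat * sDaggerMat
  | .z => 1

theorem axisMat_mem (a : PauliAxis) : axisMat a ∈ Matrix.unitaryGroup Bool ℂ := by
  cases a
  · exact hadamardMat_mem
  · exact mul_mem hadamardMat_mem sDaggerMat_mem
  · exact one_mem _

/-- The randomized-measurement circuit on one copy of the history state: the preparation, then the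
gate `axisMat (β j)` on each clock qubit `j`. -/
def randomizedCircuit {n k : ℕ} {H : Matrix (Fin n → Bool) (Fin n → Bool) ℂ}
    (hH : H.IsHermitian) (ε : ℝ) (β : Fin k → PauliAxis) : Circuit (HistoryQubit n k) :=
  historyCircuit (Function.Embedding.refl _) hH ε ++
  List.ofFn fun j : Fin k =>
    gateOn (axisMat (β j)) (axisMat_mem (β j)) (Sum.inl j : HistoryQubit n k)

/-- What is recorded in one randomized measurement of the clock (a classical shadow): for every
clock qubit the random axis and the measured bit. -/
abbrev ShadowRecord (k : ℕ) : Type := (Fin k → PauliAxis) × (Fin k → Bool)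

/-- The probability of a record in one experiment: the axes are drawn independently and uniformly,
then the circuit is run and the clock qubits are measured. -/
def shadowProb {n k : ℕ} {H : Matrix (Fin n → Bool) (Fin n → Bool) ℂ}
    (hH : H.IsHermitian) (ε : ℝ) (ψ₀ : QState (Fin n)) (s : ShadowRecord k) : ℝ :=
  (1 / 3) ^ k *
    bornProb ((randomizedCircuit hH ε s.1).run (historyInput k ψ₀)) (fun j => Sum.inl j) s.2

end

open scoped Matrix

/-! Let `χ(d) = ⟨ψ₀, U(ε d) ψ₀⟩`. By the group law and unitarity the clock state has entries `2^(-k)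
χ(t - t')`: it is a Toeplitz matrix. Hence the purity is `4^(-k) ∑ |χ(a - b)|²` over all pairs `a, b
< 2^k` (`linearEntropy_eq`).

Part (1). In the Bell basis the SWAP of each pair of clock qubits is diagonal, with the sign of the
outcome as eigenvalue. The mean of `swapSign` is therefore `Tr ρ_T²`, and Chebyshev's inequality for
a variable with values `±1` gives `C = 1 / η`.

Part (2). Because of the Toeplitz structure, `χ(d)` can be read off through any expansion of `d` in
signed binary digits `-1, 0, 1`. On each qubit with a nonzero digit one measures `X ± iY`, on the
others nothing. The resulting estimate is unbiased and its second moment is 6 to the number of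
nonzero digits (`sum_shadowProb_mul_shadowEstimate`, `sum_shadowProb_mul_normSq`). The digitwise
differences `a_j - b_j` would have total cost `14^k` over all pairs, an average of `3.5^k`, which is
too large. For expansions of smallest cost an odd number can be written as `2e + 1` or `2e - 1`, and
one of the two choices makes `e` even, so that its lowest digit is free. This gives a two-step
recurrence with characteristic equation `x² = 2x + 48`, whose dominant root is 8. The total cost is
at most `11 * 8^k` (`totalCost_le`), an average of order `2^k = N`.

The plug-in estimate of the purity then has mean absolute error controlled by `N / M`, and Markov's
inequality concludes. -/

/-! ### Layers of gates and the preparation of the history state -/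

theorem gateOn_apply {ι : Type} [DecidableEq ι] (u : Matrix Bool Bool ℂ)
    (hu : u ∈ Matrix.unitaryGroup Bool ℂ) (q : ι) (ψ : QState ι) (x : ι → Bool) :
    (gateOn u hu q).apply ψ x = ∑ b, u (x q) b * ψ (Function.update x q b) := by
  have hE : ∀ y : Fin 1 → Bool,
      Function.extend (fun _ : Fin 1 => q) y x = Function.update x q (y 0) := by
    intro y
    have hi : Function.Injective (fun _ : Fin 1 => q) := fun a b _ => Subsingleton.elim a b
    funext i
    by_cases h : i = q
    · subst h
      rw [Function.update_self]
      exact hi.extend_apply y x 0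
    · rw [Function.update_of_ne h, Function.extend_apply' _ _ _ (by rintro ⟨a, ha⟩; exact h ha.symm)]
  have key : (gateOn u hu q).apply ψ x
      = ∑ y : Fin 1 → Bool, u (x q) (y 0) * ψ (Function.extend (fun _ : Fin 1 => q) y x) := by
    simp [Gate.apply, gateOn, oneQubit]
    rfl
  rw [key]
  simp only [hE]
  exact Fintype.sum_equiv (Equiv.funUnique (Fin 1) Bool) _ _ (fun z => rfl)

theorem cnotOn_apply {ι : Type} [DecidableEq ι] (c q : ι) (h : q ≠ c) (ψ : QState ι)
    (x : ι → Bool) :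
    (cnotOn c q h).apply ψ x = ψ (Function.update x q (xor (x q) (x c))) := by
  have h1 : (cnotOn c q h).apply ψ x
      = if x c = true then (gateOn pauliXMat pauliXMat_mem q).apply ψ x else ψ x := by
    simp [Gate.apply, gateOn, cnotOn]
    rfl
  rw [h1, gateOn_apply]
  cases hc : x c
  · simp
  · cases hq : x q <;> simp [pauliXMat]

/-- Absorbs the bit changed by the first gate of a layer into the bits changed by the rest; this is
the induction step for layers of one-qubit gates and of CNOTs. -/
theorem extend_extend_cons {ι : Type} [DecidableEq ι] {k : ℕ} {q : Fin (k + 1) → ι}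
    (hq : Function.Injective q) (b : Bool) (y : Fin k → Bool) (x : ι → Bool) :
    Function.update (Function.extend (fun j : Fin k => q j.succ) y x) (q 0) b
      = Function.extend q (Fin.cons b y : Fin (k + 1) → Bool) x := by
  have hs : Function.Injective (fun j : Fin k => q j.succ) := fun a c h =>
    Fin.succ_injective _ (hq h)
  funext i
  by_cases hi : ∃ j, q j = i
  · obtain ⟨j, rfl⟩ := hi
    rw [hq.extend_apply]
    refine Fin.cases ?_ (fun j => ?_) j
    · simp
    · rw [Function.update_of_ne (fun h => Fin.succ_ne_zero _ (hq h))]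
      simpa using hs.extend_apply y x j
  · rw [Function.update_of_ne (fun h => hi ⟨0, h.symm⟩), Function.extend_apply' _ _ _ hi,
      Function.extend_apply' _ _ _ (fun ⟨j, hj⟩ => hi ⟨_, hj⟩)]

theorem extend_succ_apply_zero {ι : Type} {k : ℕ} {q : Fin (k + 1) → ι}
    (hq : Function.Injective q) (y : Fin k → Bool) (x : ι → Bool) :
    Function.extend (fun j : Fin k => q j.succ) y x (q 0) = x (q 0) :=
  Function.extend_apply' _ _ _ (by rintro ⟨j, hj⟩; exact Fin.succ_ne_zero _ (hq hj))

theorem run_append {ι : Type} (c d : Circuit ι) (ψ : QState ι) :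
    Circuit.run (c ++ d) ψ = Circuit.run d (Circuit.run c ψ) := by
  simp [Circuit.run]

theorem run_cons {ι : Type} (g : Gate ι) (d : Circuit ι) (ψ : QState ι) :
    Circuit.run (g :: d) ψ = Circuit.run d (g.apply ψ) := rfl

theorem sum_fin_succ_fun {α β : Type} [Fintype α] [AddCommMonoid β] {k : ℕ}
    (f : (Fin (k + 1) → α) → β) :
    ∑ y, f y = ∑ b : α, ∑ y : Fin k → α, f (Fin.cons b y) := by
  rw [← Fintype.sum_prod_type']
  exact (Fintype.sum_equiv (Fin.consEquiv fun _ => α) _ _ (fun _ => rfl)).symm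

/-- Gates on distinct qubits do not touch each other's row index, so the layer acts as the tensor
product of the matrices. -/
theorem run_gateOn {ι : Type} [DecidableEq ι] {k : ℕ} (u : Fin k → Matrix Bool Bool ℂ)
    (hu : ∀ j, u j ∈ Matrix.unitaryGroup Bool ℂ) (q : Fin k → ι) (hq : Function.Injective q)
    (ψ : QState ι) (x : ι → Bool) :
    Circuit.run (List.ofFn fun j => gateOn (u j) (hu j) (q j)) ψ x
      = ∑ y : Fin k → Bool, (∏ j, u j (x (q j)) (y j)) * ψ (Function.extend q y x) := by
  induction k generalizing ψ with
  | zero =>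
    have : ∀ y : Fin 0 → Bool, Function.extend q y x = x := fun y =>
      funext fun i => Function.extend_apply' _ _ _ (by rintro ⟨a, _⟩; exact a.elim0)
    simp [Circuit.run, this]
  | succ k ih =>
    rw [List.ofFn_succ, run_cons, ih (fun j => u j.succ) (fun j => hu j.succ) (fun j => q j.succ)
      (fun a c h => Fin.succ_injective _ (hq h)), sum_fin_succ_fun, Finset.sum_comm]
    refine Finset.sum_congr rfl fun y _ => ?_
    rw [gateOn_apply, Finset.mul_sum]
    refine Finset.sum_congr rfl fun b _ => ?_
    rw [extend_extend_cons hq, extend_succ_apply_zero hq, Fin.prod_univ_succ]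
    simp only [Fin.cons_zero, Fin.cons_succ]
    ring

/-- No target is a control, so every gate of the layer sees the original control bits. -/
theorem run_cnotOn {ι : Type} [DecidableEq ι] {k : ℕ} (c q : Fin k → ι)
    (hq : Function.Injective q) (hcq : ∀ i j, q i ≠ c j) (ψ : QState ι) (x : ι → Bool) :
    Circuit.run (List.ofFn fun j => cnotOn (c j) (q j) (hcq j j)) ψ x
      = ψ (Function.extend q (fun j => xor (x (q j)) (x (c j))) x) := by
  induction k generalizing ψ with
  | zero =>
    have : ∀ y : Fin 0 → Bool, Function.extend q y x = x := fun y =>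
      funext fun i => Function.extend_apply' _ _ _ (by rintro ⟨a, _⟩; exact a.elim0)
    simp [Circuit.run, this]
  | succ k ih =>
    rw [List.ofFn_succ, run_cons, ih (fun j => c j.succ) (fun j => q j.succ)
      (fun a c h => Fin.succ_injective _ (hq h)) (fun i j => hcq i.succ j.succ), cnotOn_apply,
      extend_extend_cons hq, extend_succ_apply_zero hq,
      Function.extend_apply' _ _ (c 0) (by rintro ⟨j, hj⟩; exact hcq _ _ hj)]
    congr 2
    funext j
    refine Fin.cases rfl (fun j => rfl) j

theorem evolution_add {n : ℕ} (H : Matrix (Fin n → Bool) (Fin n → Bool) ℂ) (s t : ℝ) :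
    evolution H (s + t) = evolution H s * evolution H t := by
  rw [evolution, evolution, evolution, ← Matrix.exp_add_of_commute]
  · rw [← add_smul]
    congr 2
    push_cast
    ring
  · exact (Commute.refl H).smul_left _ |>.smul_right _

theorem evolution_zero {n : ℕ} (H : Matrix (Fin n → Bool) (Fin n → Bool) ℂ) :
    evolution H 0 = 1 := by
  simp [evolution]

theorem extend_extend {ι κ : Type} {q : κ → ι} (hq : Function.Injective q) (y z : κ → Bool)
    (x : ι → Bool) :
    Function.extend q z (Function.extend q y x) = Function.extend q z x := by
  funext i
  by_cases hi : ∃ j, q j = i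
  · obtain ⟨j, rfl⟩ := hi
    rw [hq.extend_apply, hq.extend_apply]
  · rw [Function.extend_apply' _ _ _ hi, Function.extend_apply' _ _ _ hi,
      Function.extend_apply' _ _ _ hi]

/-- The evolution gate for time `t` on the qubits `q`, controlled by the qubit `c`. -/
noncomputable def controlledEvolution {ι : Type} {n : ℕ} (q : Fin n → ι)
    (hq : Function.Injective q) (c : ι) (hc : ∀ c' ∈ some c, ∀ i, q i ≠ c')
    {H : Matrix (Fin n → Bool) (Fin n → Bool) ℂ} (hH : H.IsHermitian) (t : ℝ) : Gate ι where
  arity := n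
  target := q
  target_injective := hq
  control := some c
  control_not_target := hc
  mat := evolution H t
  unitary := evolution_mem hH _

theorem controlledEvolution_apply {ι : Type} {n : ℕ} (q : Fin n → ι)
    (hq : Function.Injective q) (c : ι) (hc : ∀ c' ∈ some c, ∀ i, q i ≠ c')
    {H : Matrix (Fin n → Bool) (Fin n → Bool) ℂ} (hH : H.IsHermitian) (t : ℝ)
    (ψ : QState ι) (x : ι → Bool) :
    (controlledEvolution q hq c hc hH t).apply ψ x
      = ∑ y, evolution H (if x c then t else 0) (fun i => x (q i)) y *
          ψ (Function.extend q y x) := by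
  have h1 : (controlledEvolution q hq c hc hH t).apply ψ x = if x c = true then
      ∑ y, evolution H t (fun i => x (q i)) y * ψ (Function.extend q y x) else ψ x := by
    simp [Gate.apply, controlledEvolution]
    rfl
  rw [h1]
  split_ifs with h
  · rfl
  · have h2 : Function.extend q (fun i => x (q i)) x = x := by
      funext i
      by_cases hi : ∃ j, q j = i
      · obtain ⟨j, rfl⟩ := hi
        rw [hq.extend_apply]
      · rw [Function.extend_apply' _ _ _ hi]
    simp [evolution_zero, Matrix.one_apply, h2]

/-- The gates share their targets and leave all controls alone. For fixed control bits they compose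
by the group law, into one evolution for the sum of the times that are switched on. -/
theorem run_controlledEvolution {ι : Type} {n k : ℕ} (q : Fin n → ι)
    (hq : Function.Injective q) (c : Fin k → ι) (hc : ∀ j, ∀ c' ∈ some (c j), ∀ i, q i ≠ c')
    {H : Matrix (Fin n → Bool) (Fin n → Bool) ℂ} (hH : H.IsHermitian) (t : Fin k → ℝ)
    (ψ : QState ι) (x : ι → Bool) :
    Circuit.run (List.ofFn fun j => controlledEvolution q hq (c j) (hc j) hH (t j)) ψ x
      = ∑ y, evolution H (∑ j, if x (c j) then t j else 0) (fun i => x (q i)) y *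
          ψ (Function.extend q y x) := by
  induction k generalizing ψ with
  | zero =>
    have h2 : Function.extend q (fun i => x (q i)) x = x := by
      funext i
      by_cases hi : ∃ j, q j = i
      · obtain ⟨j, rfl⟩ := hi
        rw [hq.extend_apply]
      · rw [Function.extend_apply' _ _ _ hi]
    simp [Circuit.run, evolution_zero, Matrix.one_apply, h2]
  | succ k ih =>
    rw [List.ofFn_succ, run_cons, ih (fun j => c j.succ) (fun j => hc j.succ),
      Fin.sum_univ_succ, add_comm (ite _ _ _), evolution_add]
    simp only [controlledEvolution_apply, extend_extend hq, hq.extend_apply, Matrix.mul_apply,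
      Finset.sum_mul, Finset.mul_sum]
    rw [Finset.sum_comm]
    refine Finset.sum_congr rfl fun z _ => Finset.sum_congr rfl fun y _ => ?_
    rw [Function.extend_apply' _ _ (c 0) (by rintro ⟨j, hj⟩; exact hc 0 _ rfl _ hj), mul_assoc]

/-- The number with the binary digits `a`, least significant digit first. -/
def bitVal {k : ℕ} (a : Fin k → Bool) : ℕ := ∑ j, if a j then 2 ^ (j : ℕ) else 0

/-- The history state as a state of clock and system qubits. -/
noncomputable def historyAmp {n : ℕ} (k : ℕ) (H : Matrix (Fin n → Bool) (Fin n → Bool) ℂ) (ε : ℝ)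
    (ψ₀ : QState (Fin n)) (a : Fin k → Bool) (s : Fin n → Bool) : ℂ :=
  ((1 / Real.sqrt 2 : ℝ) : ℂ) ^ k * (evolution H (ε * bitVal a) *ᵥ ψ₀) s

/-- The spectator factor `R` depends only on the qubits outside the image of `e`. It lets the same
computation serve one copy (`R = 1`) and each of two copies in turn. -/
theorem historyCircuit_run {ι : Type} [DecidableEq ι] {n k : ℕ} (e : HistoryQubit n k ↪ ι)
    {H : Matrix (Fin n → Bool) (Fin n → Bool) ℂ} (hH : H.IsHermitian) (ε : ℝ)
    (ψ₀ : QState (Fin n)) (R : QState ι)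
    (hR : ∀ x x' : ι → Bool, (∀ i, (∀ p, e p ≠ i) → x i = x' i) → R x = R x') (x : ι → Bool) :
    Circuit.run (historyCircuit e hH ε)
        (fun x => historyInput k ψ₀ (fun p => x (e p)) * R x) x
      = historyAmp k H ε ψ₀ (fun j => x (e (Sum.inl j))) (fun i => x (e (Sum.inr i))) * R x := by
  have hl : Function.Injective fun j : Fin k => e (Sum.inl j) :=
    fun _ _ h => Sum.inl_injective (e.injective h)
  have hr : Function.Injective fun i : Fin n => e (Sum.inr i) :=
    fun _ _ h => Sum.inr_injective (e.injective h)
  have hlr : ∀ j i, e (Sum.inl j) ≠ e (Sum.inr i) := fun j i h => Sum.inl_ne_inr (e.injective h)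
  have h0 : historyCircuit e hH ε =
      (List.ofFn fun j : Fin k => gateOn hadamardMat hadamardMat_mem (e (Sum.inl j))) ++
      List.ofFn fun j : Fin k => controlledEvolution (fun i => e (Sum.inr i)) hr (e (Sum.inl j))
        (by
          intro c hc i
          rw [Option.mem_some_iff] at hc
          rw [← hc]
          exact (hlr j i).symm) hH (2 ^ (j : ℕ) * ε) := rfl
  rw [h0, run_append, run_controlledEvolution]
  have ht : (∑ j : Fin k, if x (e (Sum.inl j)) then (2 : ℝ) ^ (j : ℕ) * ε else 0)
      = ε * bitVal (fun j => x (e (Sum.inl j))) := by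
    rw [bitVal]
    push_cast
    rw [Finset.mul_sum]
    refine Finset.sum_congr rfl fun j _ => ?_
    split_ifs <;> simp [mul_comm]
  rw [ht, historyAmp, Matrix.mulVec, dotProduct, Finset.mul_sum, Finset.sum_mul]
  refine Finset.sum_congr rfl fun z _ => ?_
  rw [run_gateOn (fun _ => hadamardMat) (fun _ => hadamardMat_mem) _ hl]
  have hRx : ∀ y, R (Function.extend (fun j => e (Sum.inl j)) y
      (Function.extend (fun i => e (Sum.inr i)) z x)) = R x := by
    intro y
    apply hR
    intro i hi
    rw [Function.extend_apply' _ _ _ (by rintro ⟨j, hj⟩; exact hi _ hj),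
      Function.extend_apply' _ _ _ (by rintro ⟨j, hj⟩; exact hi _ hj)]
  have hin : ∀ y, historyInput k ψ₀ (fun p => Function.extend (fun j => e (Sum.inl j)) y
      (Function.extend (fun i => e (Sum.inr i)) z x) (e p))
        = if y = fun _ => false then ψ₀ z else 0 := by
    intro y
    have h1 : ∀ j, Function.extend (fun j => e (Sum.inl j)) y
      (Function.extend (fun i => e (Sum.inr i)) z x) (e (Sum.inl j)) = y j :=
      fun j => hl.extend_apply y _ j
    have h2 : ∀ i, Function.extend (fun j => e (Sum.inl j)) y
      (Function.extend (fun i => e (Sum.inr i)) z x) (e (Sum.inr i)) = z i := by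
      intro i
      rw [Function.extend_apply' _ _ _ (by rintro ⟨j, hj⟩; exact hlr _ _ hj)]
      exact hr.extend_apply z _ i
    simp only [historyInput, h1, h2, funext_iff]
  simp only [hRx, hin]
  -- Only the clock string `0…0` is present in the input, and each Hadamard gate contributes the
  -- constant `1/√2` from its first column.
  rw [Finset.sum_eq_single (fun _ => false) (by intro b _ hb; simp [hb]) (by simp)]
  simp [hadamardMat]
  ring

/-! ### Expectations under the Born rule -/

theorem sum_mul_bornProb {ι μ : Type} [Fintype ι] [DecidableEq ι] [Fintype μ] [DecidableEq μ]
    (ψ : QState ι) (q : μ → ι) (f : (μ → Bool) → ℂ) :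
    ∑ o, f o * (bornProb ψ q o : ℂ) =
      ∑ x : ι → Bool, f (fun m => x (q m)) * (ψ x * star (ψ x)) := by
  simp only [bornProb, Complex.ofReal_sum, Finset.mul_sum]
  rw [Finset.sum_comm]
  refine Finset.sum_congr rfl fun x _ => ?_
  rw [Finset.sum_eq_single (fun m => x (q m))]
  · simp [Complex.mul_conj, Complex.normSq_eq_norm_sq]
  · intro o _ ho
    rw [if_neg (fun h => ho (funext fun m => (h m).symm))]
    simp
  · simp

theorem bornProb_nonneg {ι μ : Type} [Fintype ι] [DecidableEq ι] [Fintype μ]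
    (ψ : QState ι) (q : μ → ι) (o : μ → Bool) : 0 ≤ bornProb ψ q o :=
  Finset.sum_nonneg fun x _ => by split_ifs <;> positivity

/-- Expectation of a product function of the bits measured after one-qubit operations. -/
theorem sum_prod_mul_local {κ : Type} [Fintype κ] [DecidableEq κ]
    (u : κ → Bool → Bool → ℂ) (h : κ → Bool → ℂ) (Φ : (κ → Bool) → ℂ) :
    ∑ x : κ → Bool, (∏ j, h j (x j)) * ((∑ y : κ → Bool, (∏ j, u j (x j) (y j)) * Φ y) *
        star (∑ y : κ → Bool, (∏ j, u j (x j) (y j)) * Φ y))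
      = ∑ y : κ → Bool, ∑ y' : κ → Bool,
          (∏ j, ∑ b, h j b * (u j b (y j) * star (u j b (y' j)))) * (Φ y * star (Φ y')) := by
  have h1 : ∀ y y' : κ → Bool, (∏ j, ∑ b, h j b * (u j b (y j) * star (u j b (y' j))))
      = ∑ x : κ → Bool, ∏ j, h j (x j) * (u j (x j) (y j) * star (u j (x j) (y' j))) := by
    intro y y'
    rw [Finset.prod_univ_sum, Fintype.piFinset_univ]
  simp only [h1, star_sum, Finset.mul_sum, Finset.sum_mul]
  rw [Finset.sum_comm]
  conv_rhs => rw [Finset.sum_comm]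
  refine Finset.sum_congr rfl fun y _ => ?_
  rw [Finset.sum_comm]
  refine Finset.sum_congr rfl fun y' _ => Finset.sum_congr rfl fun x _ => ?_
  simp only [Finset.prod_mul_distrib, star_mul', star_prod]
  ring

/-! ### Independent repetitions: Markov's inequality and the variance of a mean -/

/-- Expectation of `f` in `M` independent repetitions of an experiment with law `p`. -/
noncomputable def repeatExp {α : Type} [Fintype α] (p : α → ℝ) (M : ℕ) (f : (Fin M → α) → ℝ) : ℝ :=
  ∑ r : Fin M → α, (∏ i, p (r i)) * f r

section
variable {α : Type} [Fintype α] {p : α → ℝ}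

theorem repeatExp_one (hp1 : ∑ a, p a = 1) (M : ℕ) : repeatExp p M (fun _ => 1) = 1 := by
  have h : ∏ _i : Fin M, ∑ a, p a = ∑ r : Fin M → α, ∏ i, p (r i) := by
    classical
    rw [Finset.prod_univ_sum, Fintype.piFinset_univ]
  simp only [repeatExp, mul_one]
  rw [← h, hp1]
  simp

theorem repeatExp_mono (hp : ∀ a, 0 ≤ p a) {M : ℕ} {f g : (Fin M → α) → ℝ} (h : ∀ r, f r ≤ g r) :
    repeatExp p M f ≤ repeatExp p M g :=
  Finset.sum_le_sum fun r _ => mul_le_mul_of_nonneg_left (h r) (Finset.prod_nonneg fun _ _ => hp _)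

theorem repeatExp_add (M : ℕ) (f g : (Fin M → α) → ℝ) :
    repeatExp p M (fun r => f r + g r) = repeatExp p M f + repeatExp p M g := by
  simp only [repeatExp, mul_add, Finset.sum_add_distrib]

theorem repeatExp_const_mul (M : ℕ) (c : ℝ) (f : (Fin M → α) → ℝ) :
    repeatExp p M (fun r => c * f r) = c * repeatExp p M f := by
  simp only [repeatExp, Finset.mul_sum]
  exact Finset.sum_congr rfl fun r _ => by ring

theorem repeatExp_sum {κ : Type} (s : Finset κ) (M : ℕ) (f : κ → (Fin M → α) → ℝ) :
    repeatExp p M (fun r => ∑ c ∈ s, f c r) = ∑ c ∈ s, repeatExp p M (f c) := by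
  simp only [repeatExp, Finset.mul_sum]
  exact Finset.sum_comm

/-- Markov's inequality for repeated experiments. -/
theorem one_sub_le_repeatProb (hp : ∀ a, 0 ≤ p a) (hp1 : ∑ a, p a = 1) {M : ℕ}
    {g : (Fin M → α) → ℝ} (hg : ∀ r, 0 ≤ g r) {c η : ℝ} (hc : 0 < c)
    (h : repeatExp p M g ≤ η * c) {E : Set (Fin M → α)} (hE : ∀ r, g r ≤ c → r ∈ E) :
    1 - η ≤ repeatProb p M E := by
  classical
  -- The indicator of `E` is at least `1 - g / c` at every point, since `g > c` outside `E`.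
  have h1 : 1 - η ≤ repeatExp p M (fun r => 1 + (-1 / c) * g r) := by
    rw [repeatExp_add, repeatExp_one hp1, repeatExp_const_mul]
    have : 1 / c * repeatExp p M g ≤ η := by
      rw [one_div, inv_mul_le_iff₀ hc, mul_comm]
      exact h
    have h2 : (-1 / c) * repeatExp p M g = -(1 / c * repeatExp p M g) := by ring
    linarith
  refine h1.trans ?_
  unfold repeatExp repeatProb
  refine Finset.sum_le_sum fun r _ => ?_
  have hP : 0 ≤ ∏ i, p (r i) := Finset.prod_nonneg fun _ _ => hp _
  have hgc : 0 ≤ g r / c := div_nonneg (hg r) hc.le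
  have he : 1 + (-1 / c) * g r = 1 - g r / c := by ring
  beta_reduce
  rw [he]
  split_ifs with hr
  · nlinarith
  · have : c < g r := not_le.1 fun h => hr (hE r h)
    have : 1 < g r / c := (one_lt_div hc).2 this
    nlinarith

theorem repeatProb_eq_one (hp1 : ∑ a, p a = 1) {M : ℕ} {E : Set (Fin M → α)}
    (hE : ∀ r, r ∈ E) : repeatProb p M E = 1 := by
  rw [← repeatExp_one hp1 M]
  simp [repeatProb, repeatExp, hE]

/-- Variances of independent centred variables add. The induction splits off the first experiment.
-/
theorem repeatExp_normSq_sum (hp1 : ∑ a, p a = 1) {g : α → ℂ} (hg : ∑ a, (p a : ℂ) * g a = 0)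
    (M : ℕ) :
    repeatExp p M (fun r => Complex.normSq (∑ i, g (r i)))
      = M * ∑ a, p a * Complex.normSq (g a) := by
  induction M with
  | zero => simp [repeatExp]
  | succ M ih =>
    have h1 : repeatExp p (M + 1) (fun r => Complex.normSq (∑ i, g (r i))) =
        ∑ a, ∑ r : Fin M → α, p a * (∏ i, p (r i)) * Complex.normSq (g a + ∑ i, g (r i)) := by
      rw [repeatExp, ← Fintype.sum_prod_type']
      refine (Fintype.sum_equiv (Fin.consEquiv fun _ => α) _ _ fun x => ?_).symm
      simp [Fin.prod_univ_succ, Fin.sum_univ_succ, Fin.consEquiv]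
    -- The cross term is linear in the centred first variable, so it averages to zero.
    have h2 : ∑ a, ∑ r : Fin M → α, p a * (∏ i, p (r i)) *
        (2 * (g a * star (∑ i, g (r i))).re) = 0 := by
      rw [Finset.sum_comm]
      refine Finset.sum_eq_zero fun r _ => ?_
      have h3 : ∑ a, p a * (∏ i, p (r i)) * (2 * (g a * star (∑ i, g (r i))).re)
          = (((2 * ∏ i, p (r i) : ℝ) : ℂ) * ((∑ a, (p a : ℂ) * g a) * star (∑ i, g (r i)))).re := by
        rw [Complex.re_ofReal_mul, Finset.sum_mul, Complex.re_sum, Finset.mul_sum]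
        refine Finset.sum_congr rfl fun a _ => ?_
        rw [mul_assoc (p a : ℂ), Complex.re_ofReal_mul]
        ring
      rw [h3, hg]
      simp
    have hone := repeatExp_one hp1 M
    simp only [repeatExp, mul_one] at hone ih
    rw [h1]
    simp only [Complex.normSq_add, mul_add, Finset.sum_add_distrib]
    have h2' : ∑ a, ∑ r : Fin M → α, p a * (∏ i, p (r i)) *
        (2 * (g a * (starRingEnd ℂ) (∑ i, g (r i))).re) = 0 := h2
    rw [h2', add_zero]
    have h4 : ∑ a, ∑ r : Fin M → α, p a * (∏ i, p (r i)) * Complex.normSq (g a)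
        = ∑ a, p a * Complex.normSq (g a) := by
      refine Finset.sum_congr rfl fun a _ => ?_
      calc ∑ r : Fin M → α, p a * (∏ i, p (r i)) * Complex.normSq (g a)
          = p a * Complex.normSq (g a) * ∑ r : Fin M → α, ∏ i, p (r i) := by
            rw [Finset.mul_sum]
            exact Finset.sum_congr rfl fun r _ => by ring
        _ = _ := by rw [hone, mul_one]
    have h5 : ∑ a, ∑ r : Fin M → α, p a * (∏ i, p (r i)) * Complex.normSq (∑ i, g (r i))
        = M * ∑ a, p a * Complex.normSq (g a) := by
      rw [← ih]
      simp only [mul_assoc, ← Finset.mul_sum, ← Finset.sum_mul, hp1, one_mul]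
    rw [h4, h5]
    push_cast
    ring

/-- The mean squared error of an empirical mean is at most the second moment over the number of
experiments. -/
theorem repeatExp_normSq_mean_sub_le (hp1 : ∑ a, p a = 1) (f : α → ℂ)
    {μ : ℂ} (hμ : ∑ a, (p a : ℂ) * f a = μ) {M : ℕ} (hM : 0 < M) :
    repeatExp p M (fun r => Complex.normSq ((∑ i, f (r i)) / M - μ))
      ≤ (∑ a, p a * Complex.normSq (f a)) / M := by
  have hM' : (0 : ℝ) < M := by exact_mod_cast hM
  have hMc : (M : ℂ) ≠ 0 := by exact_mod_cast hM.ne'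
  have hp1c : ∑ a, (p a : ℂ) = 1 := by exact_mod_cast hp1
  have hg : ∑ a, (p a : ℂ) * (f a - μ) = 0 := by
    simp only [mul_sub, Finset.sum_sub_distrib, ← Finset.sum_mul, hp1c, hμ, one_mul, sub_self]
  have h1 : ∀ r : Fin M → α, Complex.normSq ((∑ i, f (r i)) / M - μ)
      = 1 / (M : ℝ) ^ 2 * Complex.normSq (∑ i, (f (r i) - μ)) := by
    intro r
    have : (∑ i, f (r i)) / M - μ = (∑ i, (f (r i) - μ)) / M := by
      rw [Finset.sum_sub_distrib]
      simp
      field_simp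
    rw [this, Complex.normSq_div, Complex.normSq_natCast]
    ring
  simp only [h1]
  rw [repeatExp_const_mul, repeatExp_normSq_sum hp1 hg]
  -- The variance is the second moment minus `|μ|²`; the subtracted term is dropped at the end.
  have h2 : ∑ a, p a * Complex.normSq (f a - μ)
      = ∑ a, p a * Complex.normSq (f a) - Complex.normSq μ := by
    have h3 : ∀ a, p a * Complex.normSq (f a - μ) = p a * Complex.normSq (f a)
        + p a * Complex.normSq μ - 2 * ((p a : ℂ) * f a * star μ).re := by
      intro a
      rw [Complex.normSq_sub, mul_assoc, Complex.re_ofReal_mul]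
      simp only [Complex.star_def]
      ring
    simp only [h3, Finset.sum_add_distrib, Finset.sum_sub_distrib, ← Finset.sum_mul,
      ← Finset.mul_sum, hp1, ← Complex.re_sum, hμ]
    have : (μ * star μ).re = Complex.normSq μ := by
      rw [Complex.star_def, Complex.mul_conj, Complex.ofReal_re]
    rw [this]
    ring
  rw [h2]
  have h4 := Complex.normSq_nonneg μ
  calc 1 / (M : ℝ) ^ 2 * (M * (∑ a, p a * Complex.normSq (f a) - Complex.normSq μ))
      = (∑ a, p a * Complex.normSq (f a) - Complex.normSq μ) / M := by field_simp
    _ ≤ _ := by gcongr; linarith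
end

/-! ### Autocorrelation of the evolution and the linear entropy -/

/-- The overlap `⟨ψ₀, U(ε d) ψ₀⟩`. -/
noncomputable def autocorrelation {n : ℕ} (H : Matrix (Fin n → Bool) (Fin n → Bool) ℂ) (ε : ℝ)
    (ψ₀ : QState (Fin n)) (d : ℤ) : ℂ :=
  ∑ s, (evolution H (ε * d) *ᵥ ψ₀) s * star (ψ₀ s)

theorem sum_mulVec_mul_star {κ : Type} [Fintype κ] [DecidableEq κ] {U : Matrix κ κ ℂ}
    (hU : U ∈ Matrix.unitaryGroup κ ℂ) (v w : κ → ℂ) :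
    ∑ s, (U *ᵥ v) s * star ((U *ᵥ w) s) = ∑ s, v s * star (w s) := by
  have h : star U * U = 1 := Matrix.mem_unitaryGroup_iff'.1 hU
  calc ∑ s, (U *ᵥ v) s * star ((U *ᵥ w) s) = (U *ᵥ v) ⬝ᵥ star (U *ᵥ w) := rfl
    _ = v ⬝ᵥ star w := by
      rw [Matrix.star_mulVec, dotProduct_comm, ← Matrix.dotProduct_mulVec, Matrix.mulVec_mulVec,
        ← Matrix.star_eq_conjTranspose, h, Matrix.one_mulVec, dotProduct_comm]

section
variable {n k : ℕ} {H : Matrix (Fin n → Bool) (Fin n → Bool) ℂ}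

/-- Factoring `U(ε t) = U(ε t') U(ε (t - t'))` and cancelling the unitary `U(ε t')` leaves the time
difference alone. This is the source of the Toeplitz structure. -/
theorem sum_evolution_mul_star (hH : H.IsHermitian) (ε : ℝ) (ψ₀ : QState (Fin n))
    (t t' : ℤ) :
    ∑ s, (evolution H (ε * t) *ᵥ ψ₀) s * star ((evolution H (ε * t') *ᵥ ψ₀) s)
      = autocorrelation H ε ψ₀ (t - t') := by
  have h1 : evolution H (ε * t) = evolution H (ε * t') * evolution H (ε * (t - t' : ℤ)) := by
    rw [← evolution_add]
    congr 1
    push_cast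
    ring
  rw [h1, ← Matrix.mulVec_mulVec, sum_mulVec_mul_star (evolution_mem hH _)]
  rfl

/-- The Cauchy–Schwarz inequality for two unit vectors. -/
theorem norm_autocorrelation_le (hH : H.IsHermitian) (ε : ℝ) (ψ₀ : QState (Fin n))
    (hψ : ∑ x, ‖ψ₀ x‖ ^ 2 = 1) (d : ℤ) :
    ‖autocorrelation H ε ψ₀ d‖ ≤ 1 := by
  have h1 : ∑ s, ‖(evolution H (ε * d) *ᵥ ψ₀) s‖ ^ 2 = 1 := by
    have h := sum_mulVec_mul_star (evolution_mem hH (ε * d)) ψ₀ ψ₀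
    simp only [Complex.star_def, Complex.mul_conj, Complex.normSq_eq_norm_sq] at h
    rw [← hψ]
    exact_mod_cast h
  have h2 := Finset.sum_mul_sq_le_sq_mul_sq Finset.univ
    (fun s => ‖(evolution H (ε * d) *ᵥ ψ₀) s‖) (fun s => ‖ψ₀ s‖)
  rw [h1, hψ] at h2
  calc ‖autocorrelation H ε ψ₀ d‖
      ≤ ∑ s, ‖(evolution H (ε * d) *ᵥ ψ₀) s‖ * ‖ψ₀ s‖ := by
        refine (norm_sum_le _ _).trans (le_of_eq (Finset.sum_congr rfl fun s _ => ?_))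
        rw [norm_mul, norm_star]
    _ ≤ 1 := by
        have h3 : (0 : ℝ) ≤ ∑ s, ‖(evolution H (ε * d) *ᵥ ψ₀) s‖ * ‖ψ₀ s‖ :=
          Finset.sum_nonneg fun s _ => by positivity
        nlinarith

theorem sum_historyAmp_mul_star (hH : H.IsHermitian) (ε : ℝ) (ψ₀ : QState (Fin n))
    (a b : Fin k → Bool) :
    ∑ s, historyAmp k H ε ψ₀ a s * star (historyAmp k H ε ψ₀ b s)
      = (1 / 2 : ℂ) ^ k * autocorrelation H ε ψ₀ ((bitVal a : ℤ) - bitVal b) := by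
  rw [← sum_evolution_mul_star hH, Finset.mul_sum]
  refine Finset.sum_congr rfl fun s _ => ?_
  have h2 : ((1 / Real.sqrt 2 : ℝ) : ℂ) * ((1 / Real.sqrt 2 : ℝ) : ℂ) = 1 / 2 := by
    rw [← Complex.ofReal_mul, div_mul_div_comm, Real.mul_self_sqrt (by norm_num)]
    norm_num
  rw [← h2, mul_pow, historyAmp, historyAmp, star_mul', star_pow, Complex.star_def,
    Complex.conj_ofReal]
  push_cast
  ring
end

/-- Bit strings of length `k` are the numbers below `2 ^ k`. -/
def bitsEquiv (k : ℕ) : (Fin k → Bool) ≃ Fin (2 ^ k) :=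
  (Equiv.arrowCongr (Equiv.refl _) finTwoEquiv.symm).trans finFunctionFinEquiv

theorem bitsEquiv_val {k : ℕ} (a : Fin k → Bool) : (bitsEquiv k a : ℕ) = bitVal a := by
  simp only [bitsEquiv, Equiv.trans_apply, finFunctionFinEquiv_apply_val, bitVal]
  refine Finset.sum_congr rfl fun j _ => ?_
  cases h : a j <;> simp [h, finTwoEquiv]

theorem linearEntropy_eq {n : ℕ} (k : ℕ) {H : Matrix (Fin n → Bool) (Fin n → Bool) ℂ}
    (hH : H.IsHermitian) (T : ℝ) (ψ₀ : QState (Fin n)) :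
    linearEntropy (2 ^ k) H T ψ₀ = 1 - ∑ a : Fin k → Bool, ∑ b : Fin k → Bool,
      (1 / 4 : ℝ) ^ k * Complex.normSq
        (autocorrelation H (T / (2 ^ k : ℕ)) ψ₀ ((bitVal a : ℤ) - bitVal b)) := by
  have hc : ∀ t t' : Fin (2 ^ k), clockState (2 ^ k) H T ψ₀ t t'
      = (1 / 2 : ℂ) ^ k * autocorrelation H (T / (2 ^ k : ℕ)) ψ₀ ((t : ℕ) - (t' : ℕ) : ℤ) := by
    intro t t'
    have h2 : ((1 / Real.sqrt ((2 ^ k : ℕ) : ℝ) : ℝ) : ℂ) * ((1 / Real.sqrt ((2 ^ k : ℕ) : ℝ) : ℝ) : ℂ)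
        = (1 / 2 : ℂ) ^ k := by
      rw [← Complex.ofReal_mul, div_mul_div_comm, Real.mul_self_sqrt (by positivity)]
      push_cast
      simp
    rw [← sum_evolution_mul_star hH, Finset.mul_sum, ← h2]
    simp only [clockState, partialTraceRight, Matrix.of_apply, Matrix.vecMulVec_apply,
      Pi.star_apply, historyState, star_mul', Complex.star_def, Complex.conj_ofReal]
    refine Finset.sum_congr rfl fun s _ => ?_
    push_cast
    ring
  -- Hermitian symmetry turns the products of the entries `(a, b)` and `(b, a)` in the trace into
  -- squared moduli.
  have hneg : ∀ d, autocorrelation H (T / (2 ^ k : ℕ)) ψ₀ (-d)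
      = star (autocorrelation H (T / (2 ^ k : ℕ)) ψ₀ d) := by
    intro d
    have h1 := sum_evolution_mul_star hH (T / (2 ^ k : ℕ)) ψ₀ 0 d
    have h2 := sum_evolution_mul_star hH (T / (2 ^ k : ℕ)) ψ₀ d 0
    rw [zero_sub] at h1
    rw [sub_zero] at h2
    rw [← h1, ← h2, star_sum]
    refine Finset.sum_congr rfl fun s _ => ?_
    rw [star_mul', star_star, mul_comm]
  rw [linearEntropy, Matrix.trace]
  simp only [Matrix.diag_apply, Matrix.mul_apply, hc, Complex.re_sum]
  congr 1
  rw [← (bitsEquiv k).sum_comp]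
  refine Finset.sum_congr rfl fun a _ => ?_
  rw [← (bitsEquiv k).sum_comp]
  refine Finset.sum_congr rfl fun b _ => ?_
  rw [bitsEquiv_val, bitsEquiv_val, ← neg_sub (bitVal a : ℤ), hneg]
  set z := autocorrelation H (T / (2 ^ k : ℕ)) ψ₀ ((bitVal a : ℤ) - bitVal b)
  have h3 : (1 / 2 : ℂ) ^ k * z * ((1 / 2 : ℂ) ^ k * star z)
      = (((1 / 4 : ℝ) ^ k * Complex.normSq z : ℝ) : ℂ) := by
    rw [Complex.ofReal_mul, ← Complex.mul_conj, Complex.star_def]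
    have : (1 / 4 : ℂ) = 1 / 2 * (1 / 2) := by norm_num
    push_cast
    rw [this, mul_pow]
    ring
  rw [h3, Complex.ofReal_re]

/-! ### State overlap: the Bell measurement of two copies -/

/-- The contents of the overlap register, with the clock and the system bits of both copies. -/
def overlapBits (n k : ℕ) : ((Fin k → Bool) × (Fin k → Bool)) × ((Fin n → Bool) × (Fin n → Bool)) ≃
    (OverlapQubit n k → Bool) where
  toFun z p := Sum.elim (if p.1 = 0 then z.1.1 else z.1.2) (if p.1 = 0 then z.2.1 else z.2.2) p.2
  invFun x := ((fun j => x (0, Sum.inl j), fun j => x (1, Sum.inl j)),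
    (fun i => x (0, Sum.inr i), fun i => x (1, Sum.inr i)))
  left_inv z := rfl
  right_inv x := by
    funext ⟨i, q⟩
    fin_cases i <;> cases q <;> rfl

theorem overlapCircuit_run {n : ℕ} (k : ℕ) {H : Matrix (Fin n → Bool) (Fin n → Bool) ℂ}
    (hH : H.IsHermitian) (ε : ℝ) (ψ₀ : QState (Fin n)) (a b : Fin k → Bool)
    (s s' : Fin n → Bool) :
    (overlapCircuit k hH ε).run
        (fun x => historyInput k ψ₀ (fun q => x (0, q)) * historyInput k ψ₀ (fun q => x (1, q)))
        (overlapBits n k ((a, b), (s, s')))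
      = ∑ y : Fin k → Bool, (∏ j, hadamardMat (a j) (y j)) * (historyAmp k H ε ψ₀ y s *
          historyAmp k H ε ψ₀ (fun j => xor (b j) (y j)) s') := by
  have hprep : Circuit.run (historyCircuit (copyEmb 0) hH ε ++ historyCircuit (copyEmb 1) hH ε)
      (fun x : OverlapQubit n k → Bool =>
        historyInput k ψ₀ (fun q => x (0, q)) * historyInput k ψ₀ (fun q => x (1, q)))
      = fun x => historyAmp k H ε ψ₀ (fun j => x (1, Sum.inl j)) (fun i => x (1, Sum.inr i)) *
        historyAmp k H ε ψ₀ (fun j => x (0, Sum.inl j)) (fun i => x (0, Sum.inr i)) := by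
    rw [run_append]
    have h1 : Circuit.run (historyCircuit (copyEmb 0) hH ε)
        (fun x : OverlapQubit n k → Bool =>
          historyInput k ψ₀ (fun q => x (0, q)) * historyInput k ψ₀ (fun q => x (1, q)))
        = fun x => historyInput k ψ₀ (fun q => x (1, q)) *
          historyAmp k H ε ψ₀ (fun j => x (0, Sum.inl j)) (fun i => x (0, Sum.inr i)) := by
      funext x
      rw [mul_comm]
      refine historyCircuit_run (copyEmb 0) hH ε ψ₀
        (fun x => historyInput k ψ₀ (fun q => x (1, q))) (fun x x' h => ?_) x
      have : ∀ q, x (1, q) = x' (1, q) := fun q =>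
        h _ fun p hp => zero_ne_one (congrArg Prod.fst hp)
      simp only [this]
    rw [h1]
    funext x
    refine historyCircuit_run (copyEmb 1) hH ε ψ₀
      (fun x => historyAmp k H ε ψ₀ (fun j => x (0, Sum.inl j)) (fun i => x (0, Sum.inr i)))
      (fun x x' h => ?_) x
    have : ∀ q, x (0, q) = x' (0, q) := fun q =>
      h _ fun p hp => one_ne_zero (congrArg Prod.fst hp)
    simp only [this]
  have hi : ∀ c : Fin 2, Function.Injective fun j : Fin k => ((c, Sum.inl j) : OverlapQubit n k) :=
    fun c j j' h => Sum.inl_injective (Prod.mk.inj h).2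
  have hcq : ∀ i j : Fin k,
      ((1, Sum.inl i) : OverlapQubit n k) ≠ ((0, Sum.inl j) : OverlapQubit n k) :=
    fun i j h => one_ne_zero (congrArg Prod.fst h)
  rw [overlapCircuit, run_append, run_append, hprep]
  refine (run_gateOn (fun _ => hadamardMat) (fun _ => hadamardMat_mem) _ (hi 0) _ _).trans ?_
  refine Finset.sum_congr rfl fun y _ => ?_
  rw [run_cnotOn (fun j : Fin k => ((0, Sum.inl j) : OverlapQubit n k))
    (fun j => (1, Sum.inl j)) (hi 1) hcq]
  have hx : Function.extend (fun j : Fin k => ((0, Sum.inl j) : OverlapQubit n k)) y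
      (overlapBits n k ((a, b), (s, s'))) = overlapBits n k ((y, b), (s, s')) := by
    funext ⟨c, q⟩
    by_cases h : ∃ j : Fin k, ((0, Sum.inl j) : OverlapQubit n k) = (c, q)
    · obtain ⟨j, h⟩ := h
      rw [← h]
      exact (hi 0).extend_apply y _ j
    · rw [Function.extend_apply' _ _ _ h]
      fin_cases c <;> rcases q with j | i <;> (first | rfl | exact absurd ⟨j, rfl⟩ h)
  rw [hx]
  have hx' : Function.extend (fun j : Fin k => ((1, Sum.inl j) : OverlapQubit n k))
      (fun j => xor (overlapBits n k ((y, b), (s, s')) (1, Sum.inl j))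
        (overlapBits n k ((y, b), (s, s')) (0, Sum.inl j)))
      (overlapBits n k ((y, b), (s, s')))
      = overlapBits n k ((y, fun j => xor (b j) (y j)), (s, s')) := by
    funext ⟨c, q⟩
    by_cases h : ∃ j : Fin k, ((1, Sum.inl j) : OverlapQubit n k) = (c, q)
    · obtain ⟨j, h⟩ := h
      rw [← h]
      exact (hi 1).extend_apply _ _ j
    · rw [Function.extend_apply' _ _ _ h]
      fin_cases c <;> rcases q with j | i <;> (first | rfl | exact absurd ⟨j, rfl⟩ h)
  rw [hx', mul_comm (historyAmp k H ε ψ₀ y s)]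
  rfl

/-- A product of indicators. -/
theorem prod_ite_eq {k : ℕ} (f g : Fin k → Bool) :
    (∏ j, if f j = g j then (1 : ℂ) else 0) = if f = g then 1 else 0 := by
  rw [Finset.prod_ite_zero]
  simp [funext_iff]

/-- Expectation of a function of the measured bits that is a product over the clock qubits. -/
theorem sum_prod_overlapProb {n : ℕ} (k : ℕ) {H : Matrix (Fin n → Bool) (Fin n → Bool) ℂ}
    (hH : H.IsHermitian) (ε : ℝ) (ψ₀ : QState (Fin n)) (h : Bool → Bool → ℂ) :
    ∑ o : Fin 2 × Fin k → Bool, (∏ j, h (o (0, j)) (o (1, j))) * (overlapProb k hH ε ψ₀ o : ℂ)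
      = ∑ b : Fin k → Bool, ∑ s : Fin n → Bool, ∑ s' : Fin n → Bool, ∑ y : Fin k → Bool,
          ∑ y' : Fin k → Bool,
          (∏ j, ∑ c, h c (b j) * (hadamardMat c (y j) * star (hadamardMat c (y' j)))) *
          ((historyAmp k H ε ψ₀ y s * historyAmp k H ε ψ₀ (fun j => xor (b j) (y j)) s') *
          star (historyAmp k H ε ψ₀ y' s * historyAmp k H ε ψ₀ (fun j => xor (b j) (y' j)) s')) := by
  simp only [overlapProb]
  rw [sum_mul_bornProb, ← (overlapBits n k).sum_comp]
  simp only [Fintype.sum_prod_type, overlapCircuit_run]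
  rw [Finset.sum_comm]
  refine Finset.sum_congr rfl fun b _ => ?_
  rw [Finset.sum_comm]
  refine Finset.sum_congr rfl fun s _ => ?_
  rw [Finset.sum_comm]
  refine Finset.sum_congr rfl fun s' _ => ?_
  rw [← sum_prod_mul_local (fun _ => hadamardMat) (fun j c => h c (b j))]
  rfl

theorem sum_hadamardMat_mul (y y' : Bool) :
    ∑ c, (1 : ℂ) * (hadamardMat c y * star (hadamardMat c y')) = if y' = y then 1 else 0 := by
  have h2 : ((Real.sqrt 2 : ℝ) : ℂ)⁻¹ * ((Real.sqrt 2 : ℝ) : ℂ)⁻¹ = 1 / 2 := by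
    rw [← mul_inv, ← Complex.ofReal_mul, Real.mul_self_sqrt (by norm_num)]
    norm_num
  cases y <;> cases y' <;> simp [hadamardMat, h2] <;> norm_num

/-- The Hadamard gate conjugates the phase `Z^b` into the flip `X^b`. If the first copy has bit `y`
and the second `xor b y`, flipping both by `b` exchanges them, which is the action of SWAP. -/
theorem sum_sign_hadamardMat_mul (b y y' : Bool) :
    ∑ c, (if c && b then (-1 : ℂ) else 1) * (hadamardMat c y * star (hadamardMat c y'))
      = if y' = xor b y then 1 else 0 := by
  have h2 : ((Real.sqrt 2 : ℝ) : ℂ)⁻¹ * ((Real.sqrt 2 : ℝ) : ℂ)⁻¹ = 1 / 2 := by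
    rw [← mul_inv, ← Complex.ofReal_mul, Real.mul_self_sqrt (by norm_num)]
    norm_num
  cases b <;> cases y <;> cases y' <;> simp [hadamardMat, h2] <;> norm_num

theorem sum_historyAmp_normSq {n k : ℕ} {H : Matrix (Fin n → Bool) (Fin n → Bool) ℂ}
    (hH : H.IsHermitian) (ε : ℝ) {ψ₀ : QState (Fin n)} (hψ : ∑ x, ‖ψ₀ x‖ ^ 2 = 1)
    (a : Fin k → Bool) :
    ∑ s, historyAmp k H ε ψ₀ a s * star (historyAmp k H ε ψ₀ a s) = (1 / 2 : ℂ) ^ k := by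
  rw [sum_historyAmp_mul_star hH, sub_self, autocorrelation]
  have h : ∑ s, ψ₀ s * star (ψ₀ s) = 1 := by
    simp only [Complex.star_def, Complex.mul_conj, Complex.normSq_eq_norm_sq]
    exact_mod_cast hψ
  simp only [Int.cast_zero, mul_zero, evolution_zero, Matrix.one_mulVec, h, mul_one]

theorem sum_overlapProb {n : ℕ} (k : ℕ) {H : Matrix (Fin n → Bool) (Fin n → Bool) ℂ}
    (hH : H.IsHermitian) (ε : ℝ) {ψ₀ : QState (Fin n)} (hψ : ∑ x, ‖ψ₀ x‖ ^ 2 = 1) :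
    ∑ o, overlapProb k hH ε ψ₀ o = 1 := by
  have h := sum_prod_overlapProb k hH ε ψ₀ (fun _ _ => 1)
  simp only [sum_hadamardMat_mul, prod_ite_eq, Finset.prod_const_one] at h
  simp only [one_mul, ite_mul, zero_mul, Finset.sum_ite_eq', Finset.mem_univ,
    if_true] at h
  have h1 : ∀ b y : Fin k → Bool, ∑ s : Fin n → Bool, ∑ s' : Fin n → Bool,
      (historyAmp k H ε ψ₀ y s * historyAmp k H ε ψ₀ (fun j => xor (b j) (y j)) s') *
      star (historyAmp k H ε ψ₀ y s * historyAmp k H ε ψ₀ (fun j => xor (b j) (y j)) s')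
      = (1 / 4 : ℂ) ^ k := by
    intro b y
    have h4 : (1 / 4 : ℂ) = 1 / 2 * (1 / 2) := by norm_num
    rw [h4, mul_pow]
    nth_rw 1 [← sum_historyAmp_normSq hH ε hψ y]
    rw [← sum_historyAmp_normSq hH ε hψ (fun j => xor (b j) (y j)), Finset.sum_mul_sum]
    refine Finset.sum_congr rfl fun s _ => Finset.sum_congr rfl fun s' _ => ?_
    rw [star_mul']
    ring
  have h2 : (∑ o, (overlapProb k hH ε ψ₀ o : ℂ)) = 1 := by
    rw [h]
    calc _ = ∑ b : Fin k → Bool, ∑ y : Fin k → Bool, (1 / 4 : ℂ) ^ k := by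
          refine Finset.sum_congr rfl fun b _ => ?_
          rw [← Finset.sum_congr rfl fun y _ => h1 b y]
          conv_rhs => rw [Finset.sum_comm]
          refine Finset.sum_congr rfl fun s _ => ?_
          rw [Finset.sum_comm]
      _ = 1 := by
          simp only [Finset.sum_const, Finset.card_univ, Fintype.card_fun, Fintype.card_bool,
            Fintype.card_fin, nsmul_eq_mul]
          push_cast
          rw [← mul_assoc, ← mul_pow, ← mul_pow]
          norm_num
  exact_mod_cast h2

theorem sum_swapSign_mul_overlapProb {n : ℕ} (k : ℕ)
    {H : Matrix (Fin n → Bool) (Fin n → Bool) ℂ} (hH : H.IsHermitian) (T : ℝ)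
    (ψ₀ : QState (Fin n)) :
    ∑ o, (overlapProb k hH (T / (2 ^ k : ℕ)) ψ₀ o : ℂ) * ((swapSign o : ℝ) : ℂ)
      = ((1 - linearEntropy (2 ^ k) H T ψ₀ : ℝ) : ℂ) := by
  have h := sum_prod_overlapProb k hH (T / (2 ^ k : ℕ)) ψ₀
    (fun c b => if c && b then (-1 : ℂ) else 1)
  simp only [sum_sign_hadamardMat_mul, prod_ite_eq] at h
  simp only [ite_mul, one_mul, zero_mul, Finset.sum_ite_eq', Finset.mem_univ,
    if_true] at h
  have h0 : ∑ o, (overlapProb k hH (T / (2 ^ k : ℕ)) ψ₀ o : ℂ) * ((swapSign o : ℝ) : ℂ)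
      = ∑ o : Fin 2 × Fin k → Bool, (∏ j, if o (0, j) && o (1, j) then (-1 : ℂ) else 1) *
        (overlapProb k hH (T / (2 ^ k : ℕ)) ψ₀ o : ℂ) := by
    refine Finset.sum_congr rfl fun o _ => ?_
    rw [mul_comm, swapSign, Complex.ofReal_prod]
    congr 1
    refine Finset.prod_congr rfl fun j _ => ?_
    split_ifs <;> simp
  rw [h0, h, linearEntropy_eq k hH]
  set A := historyAmp k H (T / (2 ^ k : ℕ)) ψ₀ with hA
  have hxx : ∀ b y : Fin k → Bool, (fun j => xor (b j) (xor (b j) (y j))) = y := fun b y =>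
    funext fun j => by simp
  simp only [hxx]
  -- The system sums factor into a matrix entry of `ρ_T` and its conjugate.
  have hpair : ∀ y z : Fin k → Bool, ∑ s, ∑ s', A y s * A z s' * star (A z s * A y s')
      = (((1 / 4 : ℝ) ^ k * Complex.normSq (autocorrelation H (T / (2 ^ k : ℕ)) ψ₀
        ((bitVal y : ℤ) - bitVal z)) : ℝ) : ℂ) := by
    intro y z
    have h1 : ∑ s, ∑ s', A y s * A z s' * star (A z s * A y s')
        = (∑ s, A y s * star (A z s)) * star (∑ s, A y s * star (A z s)) := by
      rw [star_sum, Finset.sum_mul_sum]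
      refine Finset.sum_congr rfl fun s _ => Finset.sum_congr rfl fun s' _ => ?_
      rw [star_mul', star_mul', star_star]
      ring
    rw [h1, hA, sum_historyAmp_mul_star hH, Complex.star_def, Complex.mul_conj, Complex.normSq_mul]
    congr 2
    rw [map_pow]
    congr 1
    simp
    norm_num
  have hsub : ∀ x : ℝ, 1 - (1 - x) = x := fun x => by ring
  rw [hsub, Complex.ofReal_sum]
  simp only [Complex.ofReal_sum, ← hpair]
  calc _ = ∑ b : Fin k → Bool, ∑ y : Fin k → Bool, ∑ s, ∑ s', A y s *
        A (fun j => xor (b j) (y j)) s' * star (A (fun j => xor (b j) (y j)) s * A y s') := by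
        refine Finset.sum_congr rfl fun b _ => ?_
        conv_rhs => rw [Finset.sum_comm]
        refine Finset.sum_congr rfl fun s _ => ?_
        rw [Finset.sum_comm]
    _ = _ := by
        rw [Finset.sum_comm]
        refine Finset.sum_congr rfl fun y _ => ?_
        -- For fixed `y`, the bitwise sum `z` of `b` and `y` runs over all clock strings as `b`
        -- does.
        have hinv : Function.Involutive fun (b : Fin k → Bool) (j : Fin k) => xor (b j) (y j) :=
          fun b => funext fun j => by simp
        exact Equiv.sum_comp hinv.toPerm fun z => ∑ s, ∑ s', A y s * A z s' * star (A z s * A y s')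

theorem swapSign_mul_self {k : ℕ} (o : Fin 2 × Fin k → Bool) : swapSign o * swapSign o = 1 := by
  rw [swapSign, ← Finset.prod_mul_distrib]
  exact Finset.prod_eq_one fun j _ => by split_ifs <;> norm_num

/-- Chebyshev's inequality: the sign squares to 1, so the mean squared error is at most `1 / M`,
which is at most `η δ²`. -/
theorem overlapEstimate_concentration {η : ℝ} (hη : 0 < η) {n k : ℕ}
    {H : Matrix (Fin n → Bool) (Fin n → Bool) ℂ} (hH : H.IsHermitian)
    {ψ₀ : QState (Fin n)} (hψ : ∑ x, ‖ψ₀ x‖ ^ 2 = 1) (T : ℝ) {δ : ℝ} (hδ : 0 < δ) {M : ℕ}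
    (hM : 1 / η / δ ^ 2 ≤ M) :
    1 - η ≤ repeatProb (overlapProb k hH (T / (2 ^ k : ℕ)) ψ₀) M
      {r | |overlapEstimate r - linearEntropy (2 ^ k) H T ψ₀| ≤ δ} := by
  have hMr : (0 : ℝ) < M := lt_of_lt_of_le (by positivity) hM
  have hp1 := sum_overlapProb k hH (T / (2 ^ k : ℕ)) hψ
  have hvar := repeatExp_normSq_mean_sub_le hp1 (fun o => ((swapSign o : ℝ) : ℂ))
    (sum_swapSign_mul_overlapProb k hH T ψ₀) (M := M) (by exact_mod_cast hMr)
  simp only [Complex.normSq_ofReal, swapSign_mul_self, mul_one, hp1] at hvar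
  refine one_sub_le_repeatProb (fun o => bornProb_nonneg _ _ _) hp1
    (fun r => Complex.normSq_nonneg _) (c := δ ^ 2) (by positivity) (hvar.trans ?_) fun r hr => ?_
  · rw [div_le_iff₀ hMr]
    rw [div_le_iff₀ (by positivity), div_le_iff₀ hη] at hM
    linarith
  · have h1 : (∑ i, ((swapSign (r i) : ℝ) : ℂ)) / M - ((1 - linearEntropy (2 ^ k) H T ψ₀ : ℝ) : ℂ)
        = ((-(overlapEstimate r - linearEntropy (2 ^ k) H T ψ₀) : ℝ) : ℂ) := by
      rw [overlapEstimate]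
      push_cast
      ring
    rw [h1, Complex.normSq_ofReal, neg_mul_neg, ← sq] at hr
    exact abs_le_of_sq_le_sq hr hδ.le

/-! ### Signed binary digits and the total cost of all differences -/

/-- The value of a string of signed binary digits, least significant digit first. -/
def digitVal {k : ℕ} (v : Fin k → SignType) : ℤ := ∑ j, (v j : ℤ) * 2 ^ (j : ℕ)

/-- `6` to the power of the number of nonzero digits. -/
def digitCost {k : ℕ} (v : Fin k → SignType) : ℕ := ∏ j, if v j = 0 then 1 else 6

theorem digitVal_cons {k : ℕ} (s : SignType) (v : Fin k → SignType) :
    digitVal (Fin.cons s v : Fin (k + 1) → SignType) = s + 2 * digitVal v := by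
  simp only [digitVal, Fin.sum_univ_succ, Fin.cons_zero, Fin.cons_succ, Finset.mul_sum]
  simp [pow_succ]
  exact Finset.sum_congr rfl fun j _ => by ring

theorem digitCost_cons {k : ℕ} (s : SignType) (v : Fin k → SignType) :
    digitCost (Fin.cons s v : Fin (k + 1) → SignType) = (if s = 0 then 1 else 6) * digitCost v := by
  simp [digitCost, Fin.prod_univ_succ]

theorem exists_digitVal (k : ℕ) (d : ℤ) (h : |d| < 2 ^ k) :
    ∃ v : Fin k → SignType, digitVal v = d := by
  induction k generalizing d with
  | zero => exact ⟨Fin.elim0, by simp at h; simp [digitVal, h]⟩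
  | succ k ih =>
    rw [abs_lt, pow_succ] at h
    have key : ∀ (s : SignType) (e : ℤ), d = s + 2 * e → |e| < 2 ^ k →
        ∃ v : Fin (k + 1) → SignType, digitVal v = d := by
      intro s e hd he
      obtain ⟨v, hv⟩ := ih e he
      exact ⟨Fin.cons s v, by rw [digitVal_cons, hv, hd]⟩
    rcases Int.even_or_odd' d with ⟨e, he | he⟩
    · exact key 0 e (by simp [he]) (by rw [abs_lt]; constructor <;> linarith)
    -- For `d = 2e + 1` negative, `e` may equal `-2^k`, which is out of range. The digit `-1` with
    -- quotient `e + 1` stays inside.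
    · rcases lt_or_ge e 0 with h0 | h0
      · exact key (-1) (e + 1) (by simp [he]; ring) (by rw [abs_lt]; constructor <;> linarith)
      · exact key 1 e (by simp [he]; ring) (by rw [abs_lt]; constructor <;> linarith)

/-- The smallest cost of a string of `k` signed digits with value `d`. -/
noncomputable def minCost (k : ℕ) (d : ℤ) : ℕ :=
  sInf {c | ∃ v : Fin k → SignType, digitVal v = d ∧ digitCost v = c}

/-- The bound on `d` makes the set of costs nonempty; otherwise the infimum would be the default
value 0 and would not be attained. -/
theorem minCost_spec {k : ℕ} {d : ℤ} (h : |d| < 2 ^ k) :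
    ∃ v : Fin k → SignType, digitVal v = d ∧ digitCost v = minCost k d := by
  obtain ⟨v, hv⟩ := exists_digitVal k d h
  exact Nat.sInf_mem (s := {c | ∃ v : Fin k → SignType, digitVal v = d ∧ digitCost v = c})
    ⟨_, v, hv, rfl⟩

theorem minCost_le {k : ℕ} (v : Fin k → SignType) : minCost k (digitVal v) ≤ digitCost v :=
  Nat.sInf_le ⟨v, rfl, rfl⟩

theorem minCost_succ_le {k : ℕ} (s : SignType) {e : ℤ} (h : |e| < 2 ^ k) :
    minCost (k + 1) (s + 2 * e) ≤ (if s = 0 then 1 else 6) * minCost k e := by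
  obtain ⟨v, hv, hc⟩ := minCost_spec h
  rw [← hv, ← digitVal_cons, hv, ← hc, ← digitCost_cons]
  exact minCost_le _

theorem minCost_two_mul {k : ℕ} {e : ℤ} (h : |e| < 2 ^ k) :
    minCost (k + 1) (2 * e) ≤ minCost k e := by
  simpa using minCost_succ_le 0 h

theorem minCost_two_mul_add_one {k : ℕ} {e : ℤ} (h : |e| < 2 ^ k) :
    minCost (k + 1) (2 * e + 1) ≤ 6 * minCost k e := by
  simpa [add_comm] using minCost_succ_le 1 h

theorem minCost_two_mul_sub_one {k : ℕ} {e : ℤ} (h : |e| < 2 ^ k) :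
    minCost (k + 1) (2 * e - 1) ≤ 6 * minCost k e := by
  have := minCost_succ_le (-1) h
  simpa [sub_eq_neg_add] using this

theorem abs_sub_lt_of_lt {K a b : ℕ} (ha : a < K) (hb : b < K) : |(a : ℤ) - b| < K := by
  rw [abs_lt]
  constructor <;> omega

theorem sum_range_two_mul {β : Type} [AddCommMonoid β] (f : ℕ → β) (n : ℕ) :
    ∑ i ∈ Finset.range (2 * n), f i = ∑ i ∈ Finset.range n, (f (2 * i) + f (2 * i + 1)) := by
  induction n with
  | zero => simp
  | succ n ih =>
    rw [show 2 * (n + 1) = 2 * n + 1 + 1 by ring, Finset.sum_range_succ, Finset.sum_range_succ, ih,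
      Finset.sum_range_succ]
    abel

/-- Total cost of the differences of two numbers below `2 ^ k`. -/
noncomputable def totalCost (k : ℕ) : ℕ :=
  ∑ a ∈ Finset.range (2 ^ k), ∑ b ∈ Finset.range (2 ^ k), minCost k ((a : ℤ) - b)

/-- Total cost of the even differences of two numbers below `2 ^ k`. -/
noncomputable def evenCost (k : ℕ) : ℕ :=
  ∑ a ∈ Finset.range (2 ^ k), ∑ b ∈ Finset.range (2 ^ k),
    if Even ((a : ℤ) - b) then minCost k ((a : ℤ) - b) else 0

/-- A difference is even exactly when the lowest bits agree. This happens in two ways for each pair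
of remaining strings, and the new digit 0 is free. -/
theorem evenCost_succ_le (k : ℕ) : evenCost (k + 1) ≤ 2 * totalCost k := by
  rw [evenCost, totalCost, pow_succ, mul_comm (2 ^ k) 2, sum_range_two_mul, Finset.mul_sum]
  refine Finset.sum_le_sum fun a ha => ?_
  rw [sum_range_two_mul, sum_range_two_mul, ← Finset.sum_add_distrib, Finset.mul_sum]
  refine Finset.sum_le_sum fun b hb => ?_
  have h : |(a : ℤ) - b| < 2 ^ k := by
    exact_mod_cast abs_sub_lt_of_lt (Finset.mem_range.1 ha) (Finset.mem_range.1 hb)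
  have h1 : ((2 * a : ℕ) : ℤ) - (2 * b : ℕ) = 2 * ((a : ℤ) - b) := by push_cast; ring
  have h2 : ((2 * a + 1 : ℕ) : ℤ) - (2 * b + 1 : ℕ) = 2 * ((a : ℤ) - b) := by push_cast; ring
  have h3 : ¬ Even (((2 * a : ℕ) : ℤ) - (2 * b + 1 : ℕ)) := by
    rw [Int.even_iff]; omega
  have h4 : ¬ Even (((2 * a + 1 : ℕ) : ℤ) - (2 * b : ℕ)) := by
    rw [Int.even_iff]; omega
  have h5 : Even (2 * ((a : ℤ) - b)) := even_two_mul _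
  rw [if_neg h3, if_neg h4, h1, h2, if_pos h5]
  have := minCost_two_mul h
  omega

/-- Each `e` has the successors `2e` and `2e + 1`, of relative costs 1 and 6. The bound pays for the
boundary row below, and it is of lower order because `7 < 8`. -/
theorem sum_minCost_le (k : ℕ) : ∑ e ∈ Finset.range (2 ^ k), minCost k (e : ℤ) ≤ 7 ^ k := by
  induction k with
  | zero =>
    have := minCost_le (Fin.elim0 : Fin 0 → SignType)
    simpa [digitVal, digitCost] using this
  | succ k ih =>
    rw [pow_succ, mul_comm (2 ^ k) 2, sum_range_two_mul]
    calc ∑ i ∈ Finset.range (2 ^ k), (minCost (k + 1) ((2 * i : ℕ) : ℤ)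
          + minCost (k + 1) ((2 * i + 1 : ℕ) : ℤ))
        ≤ ∑ i ∈ Finset.range (2 ^ k), 7 * minCost k (i : ℤ) := by
          refine Finset.sum_le_sum fun e he => ?_
          have h : |(e : ℤ)| < 2 ^ k := by
            rw [abs_of_nonneg (by positivity)]
            exact_mod_cast Finset.mem_range.1 he
          have h1 := minCost_two_mul h
          have h2 := minCost_two_mul_add_one h
          push_cast
          omega
      _ ≤ 7 ^ (k + 1) := by rw [← Finset.mul_sum, pow_succ]; omega

theorem minCost_neg_le (k : ℕ) {d : ℤ} (h : |d| < 2 ^ k) : minCost k (-d) ≤ minCost k d := by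
  obtain ⟨v, hv, hc⟩ := minCost_spec h
  have h1 : digitVal (fun j => -v j) = -d := by
    rw [← hv]
    simp [digitVal]
  have h2 : digitCost (fun j => -v j) = digitCost v := by
    have : ∀ s : SignType, -s = 0 ↔ s = 0 := by decide
    simp [digitCost, this]
  rw [← h1, ← hc, ← h2]
  exact minCost_le _

/-- The odd differences cost at most six times a neighbouring even difference, but for a boundary
row. -/
theorem sum_odd_minCost_le (k : ℕ) :
    ∑ a ∈ Finset.range (2 ^ k), ∑ b ∈ Finset.range (2 ^ k),
      (if Even ((a : ℤ) - b) then 0 else minCost (k + 1) (2 * ((a : ℤ) - b) + 1))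
      ≤ 6 * evenCost k + 6 * 7 ^ k := by
  obtain ⟨K, hK⟩ : ∃ K, 2 ^ k = K + 1 := ⟨2 ^ k - 1, (Nat.succ_pred_eq_of_pos (by positivity)).symm⟩
  have hKz : (2 : ℤ) ^ k = K + 1 := by exact_mod_cast hK
  rw [hK, Finset.sum_range_succ]
  refine add_le_add ?_ ?_
  -- If `d = a - b` is odd, write `2d + 1 = 2(d + 1) - 1`, where `d + 1 = (a + 1) - b` is even.
  -- Moving from row `a` to row `a + 1` stays in range for all rows but the last; row 0 of the even
  -- cost is not needed.
  · rw [evenCost, hK, Finset.sum_range_succ', mul_add, Finset.mul_sum]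
    refine le_add_right (Finset.sum_le_sum fun a ha => ?_)
    rw [Finset.mul_sum]
    refine Finset.sum_le_sum fun b hb => ?_
    have ha := Finset.mem_range.1 ha
    have hb := Finset.mem_range.1 hb
    split_ifs with h1 h2 h2
    · omega
    · omega
    · have h3 : |((a + 1 : ℕ) : ℤ) - b| < 2 ^ k := by
        rw [hKz]
        exact_mod_cast abs_sub_lt_of_lt (K := K + 1) (by omega) hb
      have := minCost_two_mul_sub_one h3
      rwa [show 2 * (((a + 1 : ℕ) : ℤ) - b) - 1 = 2 * ((a : ℤ) - b) + 1 by push_cast; ring] at this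
    · exfalso
      rw [Int.even_iff] at h1 h2
      omega
  -- In the last row `a = K` there is no next row. The digit `+1` is used instead, and `K - b` runs
  -- over all numbers below `2^k`.
  · calc ∑ b ∈ Finset.range (K + 1),
          (if Even ((K : ℤ) - b) then 0 else minCost (k + 1) (2 * ((K : ℤ) - b) + 1))
        ≤ ∑ b ∈ Finset.range (K + 1), 6 * minCost k ((K - b : ℕ) : ℤ) := by
          refine Finset.sum_le_sum fun b hb => ?_
          have hb := Finset.mem_range.1 hb
          have h3 : |(K : ℤ) - b| < 2 ^ k := by
            rw [hKz]
            exact_mod_cast abs_sub_lt_of_lt (K := K + 1) (by omega) hb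
          have := minCost_two_mul_add_one h3
          rw [Nat.cast_sub (by omega)]
          split_ifs
          · omega
          · exact this
      _ = 6 * ∑ b ∈ Finset.range (K + 1), minCost k (b : ℤ) := by
          rw [← Finset.mul_sum, ← Finset.sum_range_reflect (fun b : ℕ => minCost k (b : ℤ))]
          simp
      _ ≤ _ := by
          have := sum_minCost_le k
          rw [hK] at this
          omega

/-- Splitting off the lowest bits of both numbers turns a difference `d` into `2d` twice and `2d +
1`, `2d - 1` once each. Even `d` takes the digit `1` or `-1` directly and contributes 12 times the
even cost. Odd `d` borrows from an even neighbour, which contributes another 6 times the even cost,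
plus a boundary row, for each of the two signs. -/
theorem totalCost_succ_le (k : ℕ) :
    totalCost (k + 1) ≤ 2 * totalCost k + 24 * evenCost k + 12 * 7 ^ k := by
  have h0 : ∀ a ∈ Finset.range (2 ^ k), ∀ b ∈ Finset.range (2 ^ k), |(a : ℤ) - b| < 2 ^ k := by
    intro a ha b hb
    exact_mod_cast abs_sub_lt_of_lt (Finset.mem_range.1 ha) (Finset.mem_range.1 hb)
  -- Exchanging `a` and `b` negates the difference and so maps `2d + 1` to `2d - 1` form.
  have hsym : ∑ a ∈ Finset.range (2 ^ k), ∑ b ∈ Finset.range (2 ^ k),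
      (if Even ((a : ℤ) - b) then 0 else minCost (k + 1) (2 * ((a : ℤ) - b) - 1))
      ≤ ∑ a ∈ Finset.range (2 ^ k), ∑ b ∈ Finset.range (2 ^ k),
      (if Even ((a : ℤ) - b) then 0 else minCost (k + 1) (2 * ((a : ℤ) - b) + 1)) := by
    rw [Finset.sum_comm]
    refine Finset.sum_le_sum fun a ha => Finset.sum_le_sum fun b hb => ?_
    have he : Even ((b : ℤ) - a) ↔ Even ((a : ℤ) - b) := by
      rw [Int.even_iff, Int.even_iff]; omega
    simp only [he]
    split_ifs with h
    · exact le_rfl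
    · have h1 : |2 * ((a : ℤ) - b) + 1| < 2 ^ (k + 1) := by
        have := h0 a ha b hb
        rw [abs_lt] at this ⊢
        rw [pow_succ]
        constructor <;> linarith
      have := minCost_neg_le _ h1
      rwa [show -(2 * ((a : ℤ) - b) + 1) = 2 * ((b : ℤ) - a) - 1 by ring] at this
  have hodd := sum_odd_minCost_le k
  have hmain : totalCost (k + 1) ≤ ∑ a ∈ Finset.range (2 ^ k), ∑ b ∈ Finset.range (2 ^ k),
      (2 * minCost k ((a : ℤ) - b)
        + 12 * (if Even ((a : ℤ) - b) then minCost k ((a : ℤ) - b) else 0)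
        + (if Even ((a : ℤ) - b) then 0 else minCost (k + 1) (2 * ((a : ℤ) - b) + 1))
        + (if Even ((a : ℤ) - b) then 0 else minCost (k + 1) (2 * ((a : ℤ) - b) - 1))) := by
    rw [totalCost, pow_succ, mul_comm (2 ^ k) 2, sum_range_two_mul]
    refine Finset.sum_le_sum fun a ha => ?_
    rw [sum_range_two_mul, sum_range_two_mul, ← Finset.sum_add_distrib]
    refine Finset.sum_le_sum fun b hb => ?_
    have h := h0 a ha b hb
    rw [show ((2 * a : ℕ) : ℤ) - (2 * b : ℕ) = 2 * ((a : ℤ) - b) by push_cast; ring,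
      show ((2 * a + 1 : ℕ) : ℤ) - (2 * b + 1 : ℕ) = 2 * ((a : ℤ) - b) by push_cast; ring,
      show ((2 * a + 1 : ℕ) : ℤ) - (2 * b : ℕ) = 2 * ((a : ℤ) - b) + 1 by push_cast; ring,
      show ((2 * a : ℕ) : ℤ) - (2 * b + 1 : ℕ) = 2 * ((a : ℤ) - b) - 1 by push_cast; ring]
    have h1 := minCost_two_mul h
    have h2 := minCost_two_mul_add_one h
    have h3 := minCost_two_mul_sub_one h
    split_ifs <;> omega
  simp only [Finset.sum_add_distrib, ← Finset.mul_sum] at hmain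
  rw [← totalCost, ← evenCost] at hmain
  omega

/-- Eliminating the even cost gives `T(k+2) ≤ 2 T(k+1) + 48 T(k) + 12 * 7^(k+1)`. Adding `7 * 7^k`
absorbs the inhomogeneous term, as `84 + 343 ≤ 98 + 336`, and `8^k` solves what remains because `64
= 16 + 48`. The constant 11 comes from `k = 1`, where the bound is `38 + 49 ≤ 88`. -/
theorem totalCost_add_le (k : ℕ) : totalCost k + 7 * 7 ^ k ≤ 11 * 8 ^ k := by
  have h0 : totalCost 0 ≤ 1 ∧ evenCost 0 ≤ 1 := by
    have := minCost_le (Fin.elim0 : Fin 0 → SignType)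
    constructor <;> simpa [totalCost, evenCost, digitVal, digitCost] using this
  induction k using Nat.twoStepInduction with
  | zero => simp; omega
  | one =>
    have := totalCost_succ_le 0
    simp at this ⊢
    omega
  | more k ih1 ih2 =>
    have h1 : totalCost (k + 2) ≤ _ := totalCost_succ_le (k + 1)
    have h2 := evenCost_succ_le k
    simp only [pow_succ] at *
    omega

theorem totalCost_le (k : ℕ) : totalCost k ≤ 11 * 8 ^ k :=
  (Nat.le_add_right _ _).trans (totalCost_add_le k)

/-! ### Randomized measurements: unbiased estimates of the autocorrelation -/

theorem randomizedCircuit_run {n k : ℕ} {H : Matrix (Fin n → Bool) (Fin n → Bool) ℂ}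
    (hH : H.IsHermitian) (ε : ℝ) (ψ₀ : QState (Fin n)) (β : Fin k → PauliAxis)
    (x : HistoryQubit n k → Bool) :
    (randomizedCircuit hH ε β).run (historyInput k ψ₀) x
      = ∑ y : Fin k → Bool, (∏ j, axisMat (β j) (x (Sum.inl j)) (y j)) *
          historyAmp k H ε ψ₀ y (fun i => x (Sum.inr i)) := by
  have hl : Function.Injective fun j : Fin k => (Sum.inl j : HistoryQubit n k) :=
    Sum.inl_injective
  have h1 : Circuit.run (historyCircuit (Function.Embedding.refl (HistoryQubit n k)) hH ε)
      (historyInput k ψ₀)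
      = fun x => historyAmp k H ε ψ₀ (fun j => x (Sum.inl j)) (fun i => x (Sum.inr i)) := by
    funext x
    have := historyCircuit_run (Function.Embedding.refl (HistoryQubit n k)) hH ε ψ₀ (fun _ => 1)
      (fun _ _ _ => rfl) x
    simp only [mul_one] at this
    exact this
  rw [randomizedCircuit, run_append, h1, run_gateOn _ _ _ hl]
  refine Finset.sum_congr rfl fun y _ => ?_
  have h2 : ∀ j, Function.extend (fun j : Fin k => (Sum.inl j : HistoryQubit n k)) y x
      (Sum.inl j) = y j := fun j => hl.extend_apply y x j
  have h3 : ∀ i, Function.extend (fun j : Fin k => (Sum.inl j : HistoryQubit n k)) y x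
      (Sum.inr i) = x (Sum.inr i) := fun i =>
    Function.extend_apply' _ _ _ (by rintro ⟨j, hj⟩; exact Sum.inl_ne_inr hj)
  simp only [h2, h3]

/-- Expectation of a function of the record that is a product over the clock qubits. -/
theorem sum_shadowProb_mul_prod {n k : ℕ} {H : Matrix (Fin n → Bool) (Fin n → Bool) ℂ}
    (hH : H.IsHermitian) (ε : ℝ) (ψ₀ : QState (Fin n)) (f : Fin k → PauliAxis → Bool → ℂ) :
    ∑ r : ShadowRecord k, (shadowProb hH ε ψ₀ r : ℂ) * ∏ j, f j (r.1 j) (r.2 j)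
      = ∑ y : Fin k → Bool, ∑ y' : Fin k → Bool,
          (∏ j, ∑ β, ∑ b, (1 / 3 : ℂ) * f j β b *
            (axisMat β b (y j) * star (axisMat β b (y' j)))) *
          ((1 / 2 : ℂ) ^ k * autocorrelation H ε ψ₀ ((bitVal y : ℤ) - bitVal y')) := by
  have h1 : ∀ β : Fin k → PauliAxis,
      ∑ o : Fin k → Bool, (shadowProb hH ε ψ₀ (β, o) : ℂ) * ∏ j, f j (β j) (o j)
      = ∑ y : Fin k → Bool, ∑ y' : Fin k → Bool,
          (∏ j, ∑ b, (1 / 3 : ℂ) * f j (β j) b *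
            (axisMat (β j) b (y j) * star (axisMat (β j) b (y' j)))) *
          ((1 / 2 : ℂ) ^ k * autocorrelation H ε ψ₀ ((bitVal y : ℤ) - bitVal y')) := by
    intro β
    have h2 : ∑ o : Fin k → Bool, (shadowProb hH ε ψ₀ (β, o) : ℂ) * ∏ j, f j (β j) (o j)
        = ∑ o : Fin k → Bool, (∏ j, (1 / 3 : ℂ) * f j (β j) (o j)) *
          (bornProb ((randomizedCircuit hH ε β).run (historyInput k ψ₀)) (fun j => Sum.inl j) o
            : ℂ) := by
      refine Finset.sum_congr rfl fun o _ => ?_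
      rw [Finset.prod_mul_distrib, shadowProb]
      simp
      ring
    rw [h2, sum_mul_bornProb, ← (Equiv.sumArrowEquivProdArrow (Fin k) (Fin n) Bool).symm.sum_comp,
      Fintype.sum_prod_type]
    simp only [randomizedCircuit_run]
    rw [Finset.sum_comm]
    have h3 : ∀ s : Fin n → Bool, _ := fun s => sum_prod_mul_local (fun j b => axisMat (β j) b)
      (fun j b => (1 / 3 : ℂ) * f j (β j) b) (fun y => historyAmp k H ε ψ₀ y s)
    refine (Finset.sum_congr rfl fun s _ => h3 s).trans ?_
    rw [Finset.sum_comm]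
    refine Finset.sum_congr rfl fun y _ => ?_
    rw [Finset.sum_comm]
    refine Finset.sum_congr rfl fun y' _ => ?_
    rw [← Finset.mul_sum, sum_historyAmp_mul_star hH]
  rw [Fintype.sum_prod_type, Finset.sum_congr rfl fun β _ => h1 β, Finset.sum_comm]
  refine Finset.sum_congr rfl fun y _ => ?_
  rw [Finset.sum_comm]
  refine Finset.sum_congr rfl fun y' _ => ?_
  rw [← Finset.sum_mul, Finset.prod_univ_sum, Fintype.piFinset_univ]

/-- The estimate of `exp (-i s φ)` from the measurement of the qubit `|0⟩ + exp (-i φ) |1⟩`. -/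
noncomputable def phaseEstimate (s : SignType) (β : PauliAxis) (b : Bool) : ℂ :=
  if s = 0 then 1 else
    match β with
    | .x => 3 * (if b then -1 else 1)
    | .y => 3 * Complex.I * ((s : ℤ) : ℂ) * (if b then -1 else 1)
    | .z => 0

theorem sum_axis (g : PauliAxis → ℂ) : ∑ β, g β = g .x + g .y + g .z := by
  have : (Finset.univ : Finset PauliAxis) = {.x, .y, .z} := rfl
  rw [this]
  simp [add_assoc]

/-- The factor 3 undoes the probability of an axis, so for `s ≠ 0` the averaged observable is `X + i
s Y`, twice a matrix unit. The factor 2 makes up for one pair of bits having difference `s` where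
two pairs have difference 0. -/
theorem sum_phaseEstimate (s : SignType) (y y' : Bool) :
    ∑ β, ∑ b, (1 / 3 : ℂ) * phaseEstimate s β b * (axisMat β b y * star (axisMat β b y'))
      = if ((if y then 1 else 0) - (if y' then 1 else 0) : ℤ) = s then
          (if s = 0 then 1 else 2) else 0 := by
  have h2 : ((Real.sqrt 2 : ℝ) : ℂ)⁻¹ * ((Real.sqrt 2 : ℝ) : ℂ)⁻¹ = 1 / 2 := by
    rw [← mul_inv, ← Complex.ofReal_mul, Real.mul_self_sqrt (by norm_num)]
    norm_num
  rw [sum_axis]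
  have h3 : starRingEnd ℂ ((Real.sqrt 2 : ℝ) : ℂ)⁻¹ = ((Real.sqrt 2 : ℝ) : ℂ)⁻¹ := by
    rw [map_inv₀, Complex.conj_ofReal]
  generalize hr : ((Real.sqrt 2 : ℝ) : ℂ)⁻¹ = r at h2 h3
  rw [← sq] at h2
  cases s <;> cases y <;> cases y' <;>
    simp [phaseEstimate, axisMat, hadamardMat, sDaggerMat, Matrix.mul_apply, hr, h3] <;> ring_nf <;>
    (try simp only [h2, Complex.I_sq]) <;> norm_num

/-- The modulus does not depend on the measured bit, so unitarity leaves a multiple of the identity: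
`(9 + 9 + 0) / 3 = 6` for a nonzero digit. -/
theorem sum_phaseEstimate_normSq (s : SignType) (y y' : Bool) :
    ∑ β, ∑ b, (1 / 3 : ℂ) * (Complex.normSq (phaseEstimate s β b) : ℂ) *
      (axisMat β b y * star (axisMat β b y'))
      = if y' = y then (if s = 0 then 1 else 6) else 0 := by
  have h2 : ((Real.sqrt 2 : ℝ) : ℂ)⁻¹ * ((Real.sqrt 2 : ℝ) : ℂ)⁻¹ = 1 / 2 := by
    rw [← mul_inv, ← Complex.ofReal_mul, Real.mul_self_sqrt (by norm_num)]
    norm_num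
  rw [sum_axis]
  have h3 : starRingEnd ℂ ((Real.sqrt 2 : ℝ) : ℂ)⁻¹ = ((Real.sqrt 2 : ℝ) : ℂ)⁻¹ := by
    rw [map_inv₀, Complex.conj_ofReal]
  generalize hr : ((Real.sqrt 2 : ℝ) : ℂ)⁻¹ = r at h2 h3
  rw [← sq] at h2
  cases s <;> cases y <;> cases y' <;>
    simp [phaseEstimate, axisMat, hadamardMat, sDaggerMat, Matrix.mul_apply, hr, h3] <;> ring_nf <;>
    (try simp only [h2, Complex.I_sq]) <;> norm_num

/-- The estimate of the autocorrelation at the value of the signed digits `v` from one record. -/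
noncomputable def shadowEstimate {k : ℕ} (v : Fin k → SignType) (r : ShadowRecord k) : ℂ :=
  ∏ j, phaseEstimate (v j) (r.1 j) (r.2 j)

section
variable {n k : ℕ} {H : Matrix (Fin n → Bool) (Fin n → Bool) ℂ} (hH : H.IsHermitian) (ε : ℝ)

/-- Only pairs of strings with digitwise difference `v` survive. They all lie on the diagonal
`digitVal v` of the Toeplitz matrix, and their total weight `2^k` cancels the normalization. Any
digits with the same value therefore serve equally well. -/
theorem sum_shadowProb_mul_shadowEstimate (ψ₀ : QState (Fin n)) (v : Fin k → SignType) :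
    ∑ r, (shadowProb hH ε ψ₀ r : ℂ) * shadowEstimate v r
      = autocorrelation H ε ψ₀ (digitVal v) := by
  have h1 : ∀ y y' : Fin k → Bool,
      (∏ j, ∑ β, ∑ b, (1 / 3 : ℂ) * phaseEstimate (v j) β b *
        (axisMat β b (y j) * star (axisMat β b (y' j)))) *
        ((1 / 2 : ℂ) ^ k * autocorrelation H ε ψ₀ ((bitVal y : ℤ) - bitVal y'))
      = (∏ j, ∑ β, ∑ b, (1 / 3 : ℂ) * phaseEstimate (v j) β b *
        (axisMat β b (y j) * star (axisMat β b (y' j)))) *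
        ((1 / 2 : ℂ) ^ k * autocorrelation H ε ψ₀ (digitVal v)) := by
    intro y y'
    simp only [sum_phaseEstimate]
    by_cases h : ∀ j, ((if y j then 1 else 0) - (if y' j then 1 else 0) : ℤ) = v j
    · have : ((bitVal y : ℤ) - bitVal y') = digitVal v := by
        simp only [bitVal, digitVal, ← h]
        push_cast
        rw [← Finset.sum_sub_distrib]
        refine Finset.sum_congr rfl fun j _ => ?_
        split_ifs <;> ring
      rw [this]
    · obtain ⟨j, hj⟩ := not_forall.1 h
      rw [Finset.prod_eq_zero (Finset.mem_univ j) (if_neg hj), zero_mul, zero_mul]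
  have h2 : ∑ y : Fin k → Bool, ∑ y' : Fin k → Bool,
      (∏ j, ∑ β, ∑ b, (1 / 3 : ℂ) * phaseEstimate (v j) β b *
        (axisMat β b (y j) * star (axisMat β b (y' j)))) = 2 ^ k := by
    have h3 : ∀ s : SignType, ∑ y : Bool, ∑ y' : Bool,
        (if ((if y then 1 else 0) - (if y' then 1 else 0) : ℤ) = s then
          (if s = 0 then 1 else 2) else 0 : ℂ) = 2 := by
      intro s
      simp only [Fintype.sum_bool]
      cases s <;> simp <;> norm_num
    simp only [sum_phaseEstimate]
    calc _ = ∏ j : Fin k, ∑ y : Bool, ∑ y' : Bool,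
        (if ((if y then 1 else 0) - (if y' then 1 else 0) : ℤ) = v j then
          (if v j = 0 then 1 else 2) else 0 : ℂ) := by
          rw [Finset.prod_univ_sum, Fintype.piFinset_univ]
          refine Finset.sum_congr rfl fun y _ => ?_
          rw [Finset.prod_univ_sum, Fintype.piFinset_univ]
      _ = 2 ^ k := by
          rw [Finset.prod_congr rfl fun j _ => h3 (v j)]
          simp
  refine (sum_shadowProb_mul_prod hH ε ψ₀ fun j => phaseEstimate (v j)).trans ?_
  simp only [h1, ← Finset.sum_mul, h2]
  rw [← mul_assoc, ← mul_pow]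
  norm_num

/-- The squared modulus averages to a multiple of the identity on the clock, and the clock state has
trace 1. -/
theorem sum_shadowProb_mul_normSq {ψ₀ : QState (Fin n)} (hψ : ∑ x, ‖ψ₀ x‖ ^ 2 = 1)
    (v : Fin k → SignType) :
    ∑ r, shadowProb hH ε ψ₀ r * Complex.normSq (shadowEstimate v r) = digitCost v := by
  have h := sum_shadowProb_mul_prod hH ε ψ₀
    fun j β b => (Complex.normSq (phaseEstimate (v j) β b) : ℂ)
  have h0 : autocorrelation H ε ψ₀ 0 = 1 := by
    have h0 : ∑ s, ψ₀ s * star (ψ₀ s) = 1 := by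
      simp only [Complex.star_def, Complex.mul_conj, Complex.normSq_eq_norm_sq]
      exact_mod_cast hψ
    simp only [autocorrelation, Int.cast_zero, mul_zero, evolution_zero, Matrix.one_mulVec, h0]
  have h1 : ∀ y y' : Fin k → Bool,
      (∏ j, if y' j = y j then (if v j = 0 then (1 : ℂ) else 6) else 0)
        = if y' = y then (digitCost v : ℂ) else 0 := by
    intro y y'
    rw [Finset.prod_ite_zero]
    simp [funext_iff, digitCost]
  simp only [sum_phaseEstimate_normSq, h1] at h
  simp only [ite_mul, zero_mul, Finset.sum_ite_eq', Finset.mem_univ, if_true, sub_self, h0] at h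
  have h2 : (∑ r, (shadowProb hH ε ψ₀ r : ℂ) * (Complex.normSq (shadowEstimate v r) : ℂ))
      = digitCost v := by
    simp only [shadowEstimate, map_prod, Complex.ofReal_prod]
    rw [h]
    simp only [Finset.sum_const, Finset.card_univ, Fintype.card_fun, Fintype.card_bool,
      Fintype.card_fin, nsmul_eq_mul, mul_one]
    push_cast
    rw [mul_left_comm, ← mul_pow]
    norm_num
  exact_mod_cast h2

theorem sum_shadowProb {ψ₀ : QState (Fin n)} (hψ : ∑ x, ‖ψ₀ x‖ ^ 2 = 1) :
    ∑ r : ShadowRecord k, shadowProb hH ε ψ₀ r = 1 := by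
  -- With all digits 0 the estimate is constantly 1, so its second moment is the total probability.
  simpa [shadowEstimate, phaseEstimate, digitCost] using
    sum_shadowProb_mul_normSq hH ε hψ (fun _ : Fin k => 0)

theorem shadowProb_nonneg (ψ₀ : QState (Fin n)) (r : ShadowRecord k) :
    0 ≤ shadowProb hH ε ψ₀ r :=
  mul_nonneg (by positivity) (bornProb_nonneg _ _ _)
end

/-! ### The purity estimate and its concentration -/

theorem bitVal_lt {k : ℕ} (a : Fin k → Bool) : bitVal a < 2 ^ k :=
  bitsEquiv_val a ▸ (bitsEquiv k a).2

theorem exists_digits {k : ℕ} (a b : Fin k → Bool) : ∃ v : Fin k → SignType,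
    digitVal v = (bitVal a : ℤ) - bitVal b ∧
      digitCost v = minCost k ((bitVal a : ℤ) - bitVal b) :=
  minCost_spec (by exact_mod_cast abs_sub_lt_of_lt (bitVal_lt a) (bitVal_lt b))

/-- Signed digits of smallest cost for the difference of two binary numbers. -/
noncomputable def diffDigits {k : ℕ} (a b : Fin k → Bool) : Fin k → SignType :=
  (exists_digits a b).choose

theorem digitVal_diffDigits {k : ℕ} (a b : Fin k → Bool) :
    digitVal (diffDigits a b) = (bitVal a : ℤ) - bitVal b :=
  (exists_digits a b).choose_spec.1

theorem sum_digitCost_diffDigits_le (k : ℕ) :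
    ∑ a : Fin k → Bool, ∑ b : Fin k → Bool, digitCost (diffDigits a b) ≤ 11 * 8 ^ k := by
  have h : ∑ a : Fin k → Bool, ∑ b : Fin k → Bool, digitCost (diffDigits a b) = totalCost k := by
    rw [totalCost, ← Fin.sum_univ_eq_sum_range
      (fun a => ∑ b ∈ Finset.range (2 ^ k), minCost k ((a : ℤ) - b)), ← (bitsEquiv k).sum_comp]
    refine Finset.sum_congr rfl fun a _ => ?_
    rw [← Fin.sum_univ_eq_sum_range (fun b => minCost k (((bitsEquiv k a : ℕ) : ℤ) - b)),
      ← (bitsEquiv k).sum_comp]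
    refine Finset.sum_congr rfl fun b _ => ?_
    rw [bitsEquiv_val, bitsEquiv_val]
    exact (exists_digits a b).choose_spec.2
  exact h ▸ totalCost_le k

/-- The empirical mean of the estimates of one autocorrelation. -/
noncomputable def meanShadowEstimate {k M : ℕ} (v : Fin k → SignType) (r : Fin M → ShadowRecord k) :
    ℂ := (∑ i, shadowEstimate v (r i)) / M

/-- The estimate of the purity of the clock from `M` records. -/
noncomputable def purityEstimate (k M : ℕ) (r : Fin M → ShadowRecord k) : ℝ :=
  ∑ a : Fin k → Bool, ∑ b : Fin k → Bool,
    (1 / 4 : ℝ) ^ k * Complex.normSq (meanShadowEstimate (diffDigits a b) r)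

/-- The estimate of the linear entropy from `M` records. -/
noncomputable def shadowEntropyEstimate (k M : ℕ) (r : Fin M → ShadowRecord k) : ℝ :=
  1 - min 1 (purityEstimate k M r)

/-- With `x = ‖z - w‖` the left side is at most `x (2 + x)`, and `2x ≤ l x² + 1 / l`. Only mean
squares then have to be controlled, and `l` is free to be matched to the accuracy. -/
theorem abs_normSq_sub_normSq_le {z w : ℂ} (hw : ‖w‖ ≤ 1) {l : ℝ} (hl : 0 < l) :
    |Complex.normSq z - Complex.normSq w| ≤ (1 + l) * Complex.normSq (z - w) + 1 / l := by
  simp only [Complex.normSq_eq_norm_sq]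
  have h1 : |‖z‖ - ‖w‖| ≤ ‖z - w‖ := abs_norm_sub_norm_le z w
  have h2 : 2 * ‖z - w‖ ≤ l * ‖z - w‖ ^ 2 + 1 / l := by
    have h3 : l * ‖z - w‖ ^ 2 + 1 / l - 2 * ‖z - w‖ = (l * ‖z - w‖ - 1) ^ 2 / l := by
      field_simp
      ring
    have h4 : 0 ≤ (l * ‖z - w‖ - 1) ^ 2 / l := by positivity
    linarith
  have h5 : |‖z‖ ^ 2 - ‖w‖ ^ 2| = |‖z‖ - ‖w‖| * (‖z‖ + ‖w‖) := by
    rw [sq_sub_sq, abs_mul, abs_of_nonneg (by positivity), mul_comm]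
  have h6 : ‖z‖ ≤ ‖w‖ + ‖z - w‖ := by
    have := (abs_le.1 h1).2
    linarith
  rw [h5]
  have h7 : |‖z‖ - ‖w‖| * (‖z‖ + ‖w‖) ≤ ‖z - w‖ * (2 + ‖z - w‖) :=
    mul_le_mul h1 (by linarith) (by positivity) (norm_nonneg _)
  nlinarith

theorem sum_sum_quarter_pow (k : ℕ) :
    ∑ _a : Fin k → Bool, ∑ _b : Fin k → Bool, (1 / 4 : ℝ) ^ k = 1 := by
  simp only [Finset.sum_const, Finset.card_univ, Fintype.card_fun, Fintype.card_bool,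
    Fintype.card_fin, nsmul_eq_mul]
  push_cast
  rw [← mul_assoc, ← mul_pow, ← mul_pow]
  norm_num

/-- All pairs `a, b` share the same records; linearity of the expectation suffices. The weights
`4^(-k)` turn the total cost `11 * 8^k` into `11 * 2^k`. -/
theorem repeatExp_purityEstimate_error_le {n k : ℕ}
    {H : Matrix (Fin n → Bool) (Fin n → Bool) ℂ} (hH : H.IsHermitian) {ψ₀ : QState (Fin n)}
    (hψ : ∑ x, ‖ψ₀ x‖ ^ 2 = 1) (T : ℝ) {M : ℕ} (hM : 0 < M) {l : ℝ} (hl : 0 < l) :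
    repeatExp (shadowProb hH (T / (2 ^ k : ℕ)) ψ₀) M
        (fun r => |purityEstimate k M r - (1 - linearEntropy (2 ^ k) H T ψ₀)|)
      ≤ (1 + l) * (11 * 2 ^ k / M) + 1 / l := by
  have hMr : (0 : ℝ) < M := by exact_mod_cast hM
  set p := shadowProb (k := k) hH (T / (2 ^ k : ℕ)) ψ₀ with hp
  have hp0 : ∀ r, 0 ≤ p r := shadowProb_nonneg hH _ ψ₀
  have hp1 : ∑ r, p r = 1 := sum_shadowProb hH _ hψ
  set χ := autocorrelation H (T / (2 ^ k : ℕ)) ψ₀ with hχ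
  let g : (Fin k → Bool) → (Fin k → Bool) → (Fin M → ShadowRecord k) → ℝ := fun a b r =>
    Complex.normSq (meanShadowEstimate (diffDigits a b) r - χ ((bitVal a : ℤ) - bitVal b))
  have hg : ∀ a b, repeatExp p M (g a b) ≤ digitCost (diffDigits a b) / M := by
    intro a b
    have h := repeatExp_normSq_mean_sub_le hp1 (shadowEstimate (diffDigits a b))
      (sum_shadowProb_mul_shadowEstimate hH _ ψ₀ (diffDigits a b)) hM
    rw [sum_shadowProb_mul_normSq hH _ hψ, digitVal_diffDigits] at h
    exact h
  have hpt : ∀ r, |purityEstimate k M r - (1 - linearEntropy (2 ^ k) H T ψ₀)|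
      ≤ (1 + l) * (∑ a, ∑ b, (1 / 4 : ℝ) ^ k * g a b r) + 1 / l * 1 := by
    intro r
    suffices h : |purityEstimate k M r - (1 - linearEntropy (2 ^ k) H T ψ₀)|
        ≤ (1 + l) * (∑ a, ∑ b, (1 / 4 : ℝ) ^ k * g a b r)
          + 1 / l * ∑ _a : Fin k → Bool, ∑ _b : Fin k → Bool, (1 / 4 : ℝ) ^ k by
      rwa [sum_sum_quarter_pow] at h
    rw [linearEntropy_eq k hH, sub_sub_cancel, purityEstimate, ← hχ,
      Finset.mul_sum, Finset.mul_sum, ← Finset.sum_sub_distrib, ← Finset.sum_add_distrib]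
    refine (Finset.abs_sum_le_sum_abs _ _).trans (Finset.sum_le_sum fun a _ => ?_)
    rw [Finset.mul_sum, Finset.mul_sum, ← Finset.sum_sub_distrib, ← Finset.sum_add_distrib]
    refine (Finset.abs_sum_le_sum_abs _ _).trans (Finset.sum_le_sum fun b _ => ?_)
    rw [← mul_sub, abs_mul, abs_of_nonneg (by positivity : (0 : ℝ) ≤ (1 / 4) ^ k)]
    have h := abs_normSq_sub_normSq_le (z := meanShadowEstimate (diffDigits a b) r)
      (norm_autocorrelation_le hH (T / (2 ^ k : ℕ)) ψ₀ hψ ((bitVal a : ℤ) - bitVal b)) hl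
    calc _ ≤ (1 / 4 : ℝ) ^ k * ((1 + l) * g a b r + 1 / l) :=
          mul_le_mul_of_nonneg_left h (by positivity)
      _ = _ := by ring
  refine (repeatExp_mono hp0 hpt).trans ?_
  rw [repeatExp_add, repeatExp_const_mul, repeatExp_const_mul, repeatExp_one hp1, mul_one]
  refine add_le_add (mul_le_mul_of_nonneg_left ?_ (by positivity)) le_rfl
  simp only [repeatExp_sum, repeatExp_const_mul]
  calc ∑ a, ∑ b, (1 / 4 : ℝ) ^ k * repeatExp p M (g a b)
      ≤ ∑ a : Fin k → Bool, ∑ b : Fin k → Bool,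
          (1 / 4 : ℝ) ^ k * (digitCost (diffDigits a b) / M) :=
        Finset.sum_le_sum fun a _ => Finset.sum_le_sum fun b _ =>
          mul_le_mul_of_nonneg_left (hg a b) (by positivity)
    _ = (1 / 4 : ℝ) ^ k / M * ((∑ a : Fin k → Bool, ∑ b : Fin k → Bool,
          digitCost (diffDigits a b) : ℕ) : ℝ) := by
        push_cast
        simp only [Finset.mul_sum]
        exact Finset.sum_congr rfl fun a _ => Finset.sum_congr rfl fun b _ => by ring
    _ ≤ (1 / 4 : ℝ) ^ k / M * ((11 * 8 ^ k : ℕ) : ℝ) :=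
        mul_le_mul_of_nonneg_left (by exact_mod_cast sum_digitCost_diffDigits_le k)
          (by positivity)
    _ = 11 * 2 ^ k / M := by
        have : (8 : ℝ) ^ k = 4 ^ k * 2 ^ k := by rw [← mul_pow]; norm_num
        push_cast
        rw [this, one_div, inv_pow]
        field_simp

theorem linearEntropy_mem {n k : ℕ} {H : Matrix (Fin n → Bool) (Fin n → Bool) ℂ}
    (hH : H.IsHermitian) {ψ₀ : QState (Fin n)} (hψ : ∑ x, ‖ψ₀ x‖ ^ 2 = 1) (T : ℝ) :
    0 ≤ linearEntropy (2 ^ k) H T ψ₀ ∧ linearEntropy (2 ^ k) H T ψ₀ ≤ 1 := by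
  rw [linearEntropy_eq k hH]
  constructor
  · rw [sub_nonneg]
    refine le_trans ?_ (sum_sum_quarter_pow k).le
    refine Finset.sum_le_sum fun a _ => Finset.sum_le_sum fun b _ => ?_
    refine mul_le_of_le_one_right (by positivity) ?_
    rw [Complex.normSq_eq_norm_sq]
    exact pow_le_one₀ (norm_nonneg _) (norm_autocorrelation_le hH _ ψ₀ hψ _)
  · rw [sub_le_self_iff]
    exact Finset.sum_nonneg fun a _ => Finset.sum_nonneg fun b _ =>
      mul_nonneg (by positivity) (Complex.normSq_nonneg _)

theorem shadowEntropyEstimate_concentration {η : ℝ} (hη : 0 < η) {n k : ℕ}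
    {H : Matrix (Fin n → Bool) (Fin n → Bool) ℂ} (hH : H.IsHermitian)
    {ψ₀ : QState (Fin n)} (hψ : ∑ x, ‖ψ₀ x‖ ^ 2 = 1) (T : ℝ) {δ : ℝ} (hδ : 0 < δ) {M : ℕ}
    (hM : 22 * (1 + 2 / η) / η * (2 ^ k : ℕ) / δ ^ 2 ≤ M) :
    1 - η ≤ repeatProb (shadowProb hH (T / (2 ^ k : ℕ)) ψ₀) M
      {r | |shadowEntropyEstimate k M r - linearEntropy (2 ^ k) H T ψ₀| ≤ δ} := by
  obtain ⟨hE0, hE1⟩ := linearEntropy_mem (k := k) hH hψ T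
  have hp1 : ∑ r : ShadowRecord k, shadowProb hH (T / (2 ^ k : ℕ)) ψ₀ r = 1 :=
    sum_shadowProb hH _ hψ
  have hP0 : ∀ r, 0 ≤ purityEstimate k M r := fun r =>
    Finset.sum_nonneg fun a _ => Finset.sum_nonneg fun b _ =>
      mul_nonneg (by positivity) (Complex.normSq_nonneg _)
  -- For `δ ≥ 1` nothing has to be measured, since the truncation puts the estimate in `[0, 1]`
  -- together with `E₂`.
  rcases le_or_gt 1 δ with h1 | h1
  · rw [repeatProb_eq_one hp1]
    · linarith
    · intro r
      have h2 : 0 ≤ min 1 (purityEstimate k M r) := le_min zero_le_one (hP0 r)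
      have h3 : min 1 (purityEstimate k M r) ≤ 1 := min_le_left _ _
      rw [Set.mem_ofPred_eq, shadowEntropyEstimate, abs_le]
      constructor <;> linarith
  · have hMr : (0 : ℝ) < M := lt_of_lt_of_le (by positivity) hM
    -- The choice `l = 2 / (η δ)` makes `1 / l` half of the budget `η δ` in Markov's inequality. The
    -- constant in `hM` fits the other term into the other half.
    have hexp := repeatExp_purityEstimate_error_le (k := k) hH hψ T
      (M := M) (by exact_mod_cast hMr) (l := 2 / η / δ) (by positivity)
    refine one_sub_le_repeatProb (shadowProb_nonneg hH _ ψ₀) hp1 (fun r => abs_nonneg _) hδ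
      (hexp.trans ?_) fun r hr => ?_
    · have hb : 11 * 2 ^ k / M ≤ η * δ ^ 2 / (2 * (1 + 2 / η)) := by
        rw [div_le_div_iff₀ hMr (by positivity)]
        rw [div_le_iff₀ (by positivity), div_mul_eq_mul_div, div_le_iff₀ hη] at hM
        push_cast at hM
        linarith
      have hl : 1 + 2 / η / δ ≤ (1 + 2 / η) / δ := by
        rw [add_div]
        have : 1 ≤ 1 / δ := (one_le_div hδ).2 h1.le
        linarith
      calc (1 + 2 / η / δ) * (11 * 2 ^ k / M) + 1 / (2 / η / δ)
          ≤ (1 + 2 / η) / δ * (η * δ ^ 2 / (2 * (1 + 2 / η))) + 1 / (2 / η / δ) := by gcongr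
        _ = η * δ := by
          field_simp
          ring
    · rw [Set.mem_ofPred_eq, shadowEntropyEstimate]
      rw [abs_le] at hr ⊢
      -- Truncation at 1 cannot increase the error, as the true purity is at most 1.
      rcases min_cases 1 (purityEstimate k M r) with ⟨h, h'⟩ | ⟨h, h'⟩ <;> rw [h] <;>
        constructor <;> linarith [hr.1, hr.2]

theorem mainTheorem8 :
    -- state overlap on two copies: number of qubits, number of experiments
    ((∀ n k N : ℕ, N = 2 ^ k →
        (Fintype.card (OverlapQubit n k) : ℝ) = 2 * n + 2 * Real.logb 2 N) ∧
      ∀ η : ℝ, 0 < η → ∃ C : ℝ, 0 < C ∧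
        ∀ (n k N : ℕ), N = 2 ^ k →
        ∀ (H : Matrix (Fin n → Bool) (Fin n → Bool) ℂ) (hH : H.IsHermitian)
          (ψ₀ : QState (Fin n)), ∑ x, ‖ψ₀ x‖ ^ 2 = 1 →
        ∀ (T δ : ℝ), 0 < δ →
        ∀ M : ℕ, C / δ ^ 2 ≤ M →
          1 - η ≤ repeatProb (overlapProb k hH (T / N) ψ₀) M
            {r | |overlapEstimate r - linearEntropy N H T ψ₀| ≤ δ}) ∧
    -- randomized measurements on one copy: number of qubits, number of experiments
    ((∀ n k N : ℕ, N = 2 ^ k →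
        (Fintype.card (HistoryQubit n k) : ℝ) = n + Real.logb 2 N) ∧
      ∃ estimate : ∀ k M : ℕ, (Fin M → ShadowRecord k) → ℝ,
        ∀ η : ℝ, 0 < η → ∃ C : ℝ, 0 < C ∧
          ∀ (n k N : ℕ), N = 2 ^ k →
          ∀ (H : Matrix (Fin n → Bool) (Fin n → Bool) ℂ) (hH : H.IsHermitian)
            (ψ₀ : QState (Fin n)), ∑ x, ‖ψ₀ x‖ ^ 2 = 1 →
          ∀ (T δ : ℝ), 0 < δ →
          ∀ M : ℕ, C * N / δ ^ 2 ≤ M →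
            1 - η ≤ repeatProb (shadowProb hH (T / N) ψ₀) M
              {r | |estimate k M r - linearEntropy N H T ψ₀| ≤ δ}) := by
  have hlog : ∀ k : ℕ, Real.logb 2 ((2 ^ k : ℕ) : ℝ) = k := by
    intro k
    push_cast
    rw [Real.logb_pow, Real.logb_self_eq_one (by norm_num), mul_one]
  refine ⟨⟨?_, fun η hη => ⟨1 / η, by positivity, ?_⟩⟩, ?_, shadowEntropyEstimate,
    fun η hη => ⟨22 * (1 + 2 / η) / η, by positivity, ?_⟩⟩
  · rintro n k N rfl
    rw [hlog]
    simp
    ring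
  · rintro n k N rfl H hH ψ₀ hψ T δ hδ M hM
    exact overlapEstimate_concentration hη hH hψ T hδ hM
  · rintro n k N rfl
    rw [hlog]
    simp
    ring
  · rintro n k N rfl H hH ψ₀ hψ T δ hδ M hM
    exact shadowEntropyEstimate_concentration hη hH hψ T hδ hM
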